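/- Let $p\ge 1$ be an integer and let $[a,b]$ be either $[0,1]$ or $[-1,1]$. Consider the following parameterized decision problem, $[a,b]$-Parmax$_p$. Input: an integer $d\ge 1$, a rational number $\gamma$, and $d$ linearly independent vectors $v_1,\dots,v_d\in\mathbb{Q}^d$ (all rationals written as binary fractions). Parameter: $d$. Question: is $$\max\Big\{\|x\|_p^p : x\in \sum_{i=1}^d [a,b]\,v_i\Big\}\ \ge\ \gamma\,?$$ Here $\|x\|_p^p=\sum_{i=1}^d|x_i|^p$ and $\sum_{i=1}^d [a,b]\,v_i=\{\sum_{i=1}^d\lambda_i v_i : \lambda_i\in[a,b]\}$. Theorem. For every integer $p\ge 1$, both $[0,1]$-Parmax$_p$ and $[-1,1]$-Parmax$_p$ are fixed-parameter tractable: for each of them there are a Turing machine, a computable function $f:\mathbb{N}\to\mathbb{N}$ and a polynomial $q$ such that, for every string $x$ and every $d$, the machine decides in at most $f(d)\,q(|x|)$ steps whether $x$ encodes a pair $(\gamma,(v_1,\dots,v_d))$ for which $(d,\gamma,v_1,\dots,v_d)$ is a yes-instance (strings that do not encode an admissible input are rejected). -/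

import Mathlib

open scoped Pointwise

/-- An instance `(x, k)` of a parameterized problem, as a machine input: the parameter `k` in
unary, written with a symbol `none` that does not occur in `x`, followed by the string `x`. -/
def paramInput {A : Type} (x : List A) (k : ℕ) : List (Option A) :=
  List.replicate k none ++ x.map some

open Classical in
/-- Fixed-parameter tractability of a parameterized language `L` of pairs (string, parameter):
one Turing machine (Mathlib's multi-stack machine, whose finitely many input symbols are those of
`Option A`) decides `(x, k) ∈ L` for all strings `x` and all parameters `k`, in at most
`f k * q (|x|)` steps, for a computable function `f` and a polynomial `q`. -/
def IsFPT {A : Type} (L : Set (List A × ℕ)) : Prop :=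
  ∃ (M : Turing.TM2ComputableAux (Option A) Bool) (f : ℕ → ℕ) (q : Polynomial ℕ),
    Computable f ∧
      ∀ (x : List A) (k : ℕ),
        Nonempty (Turing.TM2OutputsInTime M.tm
          ((paramInput x k).map M.inputAlphabet.invFun)
          (some ((Computability.encodeBool (decide ((x, k) ∈ L))).map M.outputAlphabet.invFun))
          (f k * q.eval x.length))

/-- The symbols used to write down rational data: binary digits, a minus sign, a fraction bar, and
a comma that ends each number. -/
inductive RatSym : Type
  | bit (b : Bool)
  | minus
  | slash
  | comma

/-- The number with binary digits `l`, least significant digit first (leading zeros are allowed,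
and the empty list of digits stands for `0`). -/
def binVal (l : List Bool) : ℕ :=
  Nat.ofDigits 2 (l.map Bool.toNat)

/-- The string `s` is a (not necessarily reduced) binary fraction `±a/b`, `b ≠ 0`, of value `r`. -/
def DenotesRat (s : List RatSym) (r : ℚ) : Prop :=
  ∃ (neg : Bool) (a b : List Bool),
    s = (if neg then [RatSym.minus] else []) ++ a.map RatSym.bit
          ++ [RatSym.slash] ++ b.map RatSym.bit ∧
    binVal b ≠ 0 ∧
    r = (if neg then -1 else 1) * ((binVal a : ℚ) / (binVal b : ℚ))

/-- The string `x` lists `γ` and then the coordinates of `v 0, v 1, …, v (d - 1)`, in this order,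
each number followed by a comma. -/
def EncodesInstance {d : ℕ} (x : List RatSym) (γ : ℚ) (v : Fin d → Fin d → ℚ) : Prop :=
  ∃ (g : List RatSym) (w : Fin d → Fin d → List RatSym),
    DenotesRat g γ ∧ (∀ i j, DenotesRat (w i j) (v i j)) ∧
    x = g ++ [RatSym.comma] ++
      (List.ofFn fun i => (List.ofFn fun j => w i j ++ [RatSym.comma]).flatten).flatten

/-- The Minkowski sum `∑ᵢ [a, b] vᵢ` of line segments in `ℝᵈ`, for rational vectors `vᵢ`. -/
def parallelotope {d : ℕ} (a b : ℝ) (v : Fin d → Fin d → ℚ) : Set (Fin d → ℝ) :=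
  ∑ i, (fun t : ℝ => t • (fun j => (v i j : ℝ))) '' Set.Icc a b

/-- Is `max {‖x‖_p^p : x ∈ ∑ᵢ [a, b] vᵢ} ≥ γ`? -/
def MaxNormPowGE (p : ℕ) (a b : ℝ) {d : ℕ} (γ : ℚ) (v : Fin d → Fin d → ℚ) : Prop :=
  ∃ m : ℝ, IsGreatest
      ((fun x : Fin d → ℝ => ‖WithLp.toLp (p : ENNReal) x‖ ^ p) '' parallelotope a b v) m ∧
    (γ : ℝ) ≤ m

/-- The problem `[a, b]`-Parmax with exponent `p`, with parameter the dimension `d`, as the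
language of its (encoded) yes-instances. -/
def parmax (p : ℕ) (a b : ℝ) : Set (List RatSym × ℕ) :=
  {(x, d) | 1 ≤ d ∧ ∃ (γ : ℚ) (v : Fin d → Fin d → ℚ),
    EncodesInstance x γ v ∧ LinearIndependent ℚ v ∧ MaxNormPowGE p a b γ v}

/-! The function `x ↦ ∑ |x i| ^ p` is convex, and the parallelotope is the convex hull of the at
most `2 ^ d` points `∑ λ i • v i` in which every `λ i` is an endpoint of the interval. The maximum
is therefore attained at one of these points (`maxNormPowGE_iff`). Their values are rational, so it
suffices to evaluate all of them exactly and to compare with `γ`. Linear independence is tested by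
Gram–Schmidt orthogonalization without division (`orthogonalize_ofFn`).

The greater part of the file turns this into a Turing machine with a proven time bound. Structured
programs are compiled to `TM2` machines (`Run.steps`); they operate on binary trees whose leaves are
strings, written on a stack. A function is `Feasible` if, on trees with at most `B` nodes and of
length at most `B * (N + 1)`, a program computes it in `g B * (N + 1) ^ 2` steps, with a result
bounded by `g B` and the same `N`, for a monotone primitive recursive `g`. Since `N` does not
change, such functions compose without raising the degree of the polynomial. Even folds over lists
are admissible (`Feasible.foldl_aux`): there are at most `B` rounds, so the new bound is an iterate
of a function of `B`. Fixed-parameter tractability tolerates every computable dependence on the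
parameter, so neither the number of vertices nor the growth of unreduced fractions has to be
estimated.

The input string is a single leaf, so the whole input is bounded with `B = 2 * d + 3` and `N = |x|`;
this gives `Feasible.isFPT`. What remains is that the decision procedure is feasible
(`Feasible.decideParmax`) and correct (`decideParmax_iff`). -/

namespace StackProg

/-! ### Structured stack programs and their compilation to `TM2` machines. -/

open Turing Turing.TM2

variable {K : Type} {Γ : K → Type} {σ : Type}

/-- Structured programs over stacks. A block is a `TM2` statement, executed in one step. -/
inductive Prog (Γ : K → Type) (σ : Type) : Type
  | blk (s : Stmt Γ Unit σ)
  | seq (P Q : Prog Γ σ)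
  | ite (c : σ → Bool) (P Q : Prog Γ σ)
  | loop (P : Prog Γ σ) (c : σ → Bool)

namespace Prog

/-- Labels of the machine executing a program. -/
def Lab : Prog Γ σ → Type
  | blk _ => Unit
  | seq P Q => P.Lab ⊕ Q.Lab
  | ite _ P Q => Option (P.Lab ⊕ Q.Lab)
  | loop P _ => Option P.Lab

instance finiteLab : (P : Prog Γ σ) → Finite P.Lab
  | blk _ => inferInstanceAs (Finite Unit)
  | seq P Q =>
    have := finiteLab P
    have := finiteLab Q
    inferInstanceAs (Finite (P.Lab ⊕ Q.Lab))
  | ite _ P Q =>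
    have := finiteLab P
    have := finiteLab Q
    inferInstanceAs (Finite (Option (P.Lab ⊕ Q.Lab)))
  | loop P _ =>
    have := finiteLab P
    inferInstanceAs (Finite (Option P.Lab))

/-- The label at which the execution of a program starts. -/
def entry : (P : Prog Γ σ) → P.Lab
  | blk _ => ()
  | seq P _ => Sum.inl P.entry
  | ite _ _ _ => none
  | loop P _ => some P.entry

/-- Replace the jump at the end of a block by a jump to a given label. -/
def relabel {Λ : Type} (exit : Λ) : Stmt Γ Unit σ → Stmt Γ Λ σ
  | .push k f q => .push k f (relabel exit q)
  | .peek k f q => .peek k f (relabel exit q)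
  | .pop k f q => .pop k f (relabel exit q)
  | .load f q => .load f (relabel exit q)
  | .branch f q₁ q₂ => .branch f (relabel exit q₁) (relabel exit q₂)
  | .goto _ => .goto fun _ => exit
  | .halt => .goto fun _ => exit

/-- The machine code of a program, whose labels are embedded by `emb` into those of a larger
machine, and which jumps to `exit` when it is done. -/
def code {Λ : Type} : (P : Prog Γ σ) → (emb : P.Lab → Λ) → (exit : Λ) → P.Lab → Stmt Γ Λ σ
  | blk s, _, exit, _ => relabel exit s
  | seq P Q, emb, exit, l =>
    Sum.elim (P.code (fun l => emb (Sum.inl l)) (emb (Sum.inr Q.entry)))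
      (Q.code (fun l => emb (Sum.inr l)) exit) l
  | ite c P Q, emb, exit, l =>
    Option.elim l
      (.branch c (.goto fun _ => emb (some (Sum.inl P.entry)))
        (.goto fun _ => emb (some (Sum.inr Q.entry))))
      (Sum.elim (P.code (fun l => emb (some (Sum.inl l))) exit)
        (Q.code (fun l => emb (some (Sum.inr l))) exit))
  | loop P c, emb, exit, l =>
    Option.elim l
      (.branch c (.goto fun _ => emb (some P.entry)) (.goto fun _ => exit))
      (P.code (fun l => emb (some l)) (emb none))

end Prog

variable [DecidableEq K]

/-- The effect of a block on the registers and the stacks. -/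
def exec (s : Stmt Γ Unit σ) (S : σ × ∀ k, List (Γ k)) : σ × ∀ k, List (Γ k) :=
  ((stepAux s S.1 S.2).var, (stepAux s S.1 S.2).stk)

/-- `Run P S t S'`: started in the state `S`, the program `P` ends after `t` steps in `S'`. -/
inductive Run : Prog Γ σ → σ × (∀ k, List (Γ k)) → ℕ → σ × (∀ k, List (Γ k)) → Prop
  | blk (s S) : Run (.blk s) S 1 (exec s S)
  | seq {P Q S S' S'' t t'} : Run P S t S' → Run Q S' t' S'' → Run (.seq P Q) S (t + t') S''
  | iteTrue {c P Q S S' t} : c S.1 = true → Run P S t S' → Run (.ite c P Q) S (t + 1) S'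
  | iteFalse {c P Q S S' t} : c S.1 = false → Run Q S t S' → Run (.ite c P Q) S (t + 1) S'
  | loopDone {P c S S' t} : Run P S t S' → c S'.1 = false → Run (.loop P c) S (t + 1) S'
  | loopMore {P c S S' S'' t t'} : Run P S t S' → c S'.1 = true → Run (.loop P c) S' t' S'' →
      Run (.loop P c) S (t + 1 + t') S''

/-- The jump that ends a block is discarded by `relabel`, so the effect on the memory can be
computed once, with the trivial label type. -/
theorem stepAux_relabel {Λ : Type} (exit : Λ) (s : Stmt Γ Unit σ) (v : σ)
    (S : ∀ k, List (Γ k)) :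
    stepAux (Prog.relabel exit s) v S = ⟨some exit, (exec s (v, S)).1, (exec s (v, S)).2⟩ := by
  induction s generalizing v S with
  | push k f q ih => simpa [Prog.relabel, exec] using ih _ _
  | peek k f q ih => simpa [Prog.relabel, exec] using ih _ _
  | pop k f q ih => simpa [Prog.relabel, exec] using ih _ _
  | load f q ih => simpa [Prog.relabel, exec] using ih _ _
  | branch f q₁ q₂ ih₁ ih₂ =>
    cases h : f v
    · simpa [Prog.relabel, exec, h] using ih₂ _ _
    · simpa [Prog.relabel, exec, h] using ih₁ _ _
  | goto f => simp [Prog.relabel, exec]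
  | halt => simp [Prog.relabel, exec]

/-- Iterated steps of a machine, on configurations. -/
def stepsFrom {Λ : Type} (m : Λ → Stmt Γ Λ σ) (n : ℕ) (c : Cfg Γ Λ σ) : Option (Cfg Γ Λ σ) :=
  (flip bind (step m))^[n] (some c)

theorem stepsFrom_add {Λ : Type} {m : Λ → Stmt Γ Λ σ} {a b : ℕ} {c c' c'' : Cfg Γ Λ σ}
    (h₁ : stepsFrom m a c = some c') (h₂ : stepsFrom m b c' = some c'') :
    stepsFrom m (a + b) c = some c'' := by
  unfold stepsFrom at *
  rw [Nat.add_comm, Function.iterate_add_apply, h₁, h₂]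

theorem stepsFrom_one {Λ : Type} {m : Λ → Stmt Γ Λ σ} (l : Λ) (v : σ) (S : ∀ k, List (Γ k)) :
    stepsFrom m 1 ⟨some l, v, S⟩ = some (stepAux (m l) v S) := by
  simp [stepsFrom, flip]

/-- Correctness of the compilation. The machine `m` is arbitrary apart from containing the code of
`P`, and `exit` is generalized in the induction, because each subprogram sits in the same machine
with its own embedding and its own exit. -/
theorem Run.steps {P : Prog Γ σ} {S S' : σ × ∀ k, List (Γ k)} {t : ℕ} (h : Run P S t S')
    {Λ : Type} (m : Λ → Stmt Γ Λ σ) (emb : P.Lab → Λ) (exit : Λ)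
    (hm : ∀ l, m (emb l) = P.code emb exit l) :
    stepsFrom m t ⟨some (emb P.entry), S.1, S.2⟩ = some ⟨some exit, S'.1, S'.2⟩ := by
  induction h generalizing exit with
  | blk s S =>
    rw [stepsFrom_one, hm]
    simp [Prog.code, stepAux_relabel]
  | seq _ _ ih₁ ih₂ =>
    exact stepsFrom_add (ih₁ (fun l => emb (Sum.inl l)) _ fun l => hm (Sum.inl l))
      (ih₂ (fun l => emb (Sum.inr l)) exit fun l => hm (Sum.inr l))
  | @iteTrue c P Q S S' t hc _ ih =>
    rw [Nat.add_comm]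
    refine stepsFrom_add (c' := ⟨some (emb (some (Sum.inl P.entry))), S.1, S.2⟩) ?_
      (ih (fun l => emb (some (Sum.inl l))) exit fun l => hm (some (Sum.inl l)))
    rw [stepsFrom_one, hm]
    simp [Prog.code, Prog.entry, hc]
  | @iteFalse c P Q S S' t hc _ ih =>
    rw [Nat.add_comm]
    refine stepsFrom_add (c' := ⟨some (emb (some (Sum.inr Q.entry))), S.1, S.2⟩) ?_
      (ih (fun l => emb (some (Sum.inr l))) exit fun l => hm (some (Sum.inr l)))
    rw [stepsFrom_one, hm]
    simp [Prog.code, Prog.entry, hc]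
  | @loopDone P c S S' t _ hc ih =>
    refine stepsFrom_add (ih (fun l => emb (some l)) (emb none) fun l => hm (some l)) ?_
    rw [stepsFrom_one, show m (emb none) = _ from hm none]
    simp [Prog.code, hc]
  | @loopMore P c S S' S'' t t' _ hc _ ih₁ ih₂ =>
    refine stepsFrom_add (stepsFrom_add
      (ih₁ (fun l => emb (some l)) (emb none) fun l => hm (some l)) ?_) (ih₂ emb exit hm)
    rw [stepsFrom_one, show m (emb none) = _ from hm none]
    simp [Prog.code, hc, Prog.entry]

end StackProg

/-! ### The concrete machine: seven work stacks, three registers, and moves between stacks. -/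

namespace StackProg

open Turing Turing.TM2

/-- The symbols on the work stacks: those of the input, a symbol that ends an atom, and a symbol
that begins a pair. -/
inductive Sym : Type
  | chr (r : RatSym)
  | cut
  | mark

/-- The work stacks. -/
inductive W : Type
  | a | b | c | d | e | f | u
  deriving DecidableEq

instance : Fintype W := ⟨{.a, .b, .c, .d, .e, .f, .u}, by intro x; cases x <;> simp⟩

/-- All stacks. -/
inductive Stk : Type
  | inp
  | out
  | wk (i : W)
  deriving DecidableEq

instance : Fintype Stk :=
  ⟨{.inp, .out} ∪ Finset.univ.image .wk, by intro x; cases x <;> simp⟩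

/-- The stack alphabets. -/
def Alph : Stk → Type
  | .inp => Option RatSym
  | .out => Bool
  | .wk _ => Sym

/-- The registers: two symbols and a bit. -/
abbrev Reg : Type := Option Sym × Option Sym × Bool

instance : Finite RatSym :=
  Finite.of_surjective
    (fun x : Bool ⊕ Option (Option Unit) => match x with
      | .inl b => RatSym.bit b
      | .inr none => RatSym.minus
      | .inr (some none) => RatSym.slash
      | .inr (some (some _)) => RatSym.comma)
    (by
      rintro (b | _ | _ | _)
      exacts [⟨.inl b, rfl⟩, ⟨.inr none, rfl⟩, ⟨.inr (some none), rfl⟩, ⟨.inr (some (some ())), rfl⟩])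

instance : Finite Sym :=
  Finite.of_surjective
    (fun x : Option (Option RatSym) => match x with
      | none => Sym.cut
      | some none => Sym.mark
      | some (some r) => Sym.chr r)
    (by
      rintro (r | _ | _)
      exacts [⟨some (some r), rfl⟩, ⟨none, rfl⟩, ⟨some none, rfl⟩])

/-- Blocks and programs of the concrete machine. -/
abbrev Blk : Type := Stmt Alph Unit Reg

/-- Programs of the concrete machine. -/
abbrev Program : Type := Prog Alph Reg

/-- The contents of all stacks, given those of the work stacks; the others are empty. -/
def full (T : W → List Sym) : ∀ k, List (Alph k)
  | .inp => []
  | .out => []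
  | .wk i => T i

/-- The contents of the work stacks. -/
def tp (a b c d e f u : List Sym) : W → List Sym
  | .a => a
  | .b => b
  | .c => c
  | .d => d
  | .e => e
  | .f => f
  | .u => u

section Updates

variable (a b c d e f u x : List Sym)

@[simp] theorem tp_a : tp a b c d e f u .a = a := rfl
@[simp] theorem tp_b : tp a b c d e f u .b = b := rfl
@[simp] theorem tp_c : tp a b c d e f u .c = c := rfl
@[simp] theorem tp_d : tp a b c d e f u .d = d := rfl
@[simp] theorem tp_e : tp a b c d e f u .e = e := rfl
@[simp] theorem tp_f : tp a b c d e f u .f = f := rfl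
@[simp] theorem tp_u : tp a b c d e f u .u = u := rfl

@[simp] theorem update_tp_a : Function.update (tp a b c d e f u) .a x = tp x b c d e f u := by
  funext i; cases i <;> rfl
@[simp] theorem update_tp_b : Function.update (tp a b c d e f u) .b x = tp a x c d e f u := by
  funext i; cases i <;> rfl
@[simp] theorem update_tp_c : Function.update (tp a b c d e f u) .c x = tp a b x d e f u := by
  funext i; cases i <;> rfl
@[simp] theorem update_tp_d : Function.update (tp a b c d e f u) .d x = tp a b c x e f u := by
  funext i; cases i <;> rfl
@[simp] theorem update_tp_e : Function.update (tp a b c d e f u) .e x = tp a b c d x f u := by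
  funext i; cases i <;> rfl
@[simp] theorem update_tp_f : Function.update (tp a b c d e f u) .f x = tp a b c d e x u := by
  funext i; cases i <;> rfl
@[simp] theorem update_tp_u : Function.update (tp a b c d e f u) .u x = tp a b c d e f x := by
  funext i; cases i <;> rfl

end Updates

/-- Push a symbol on a work stack. -/
def push (i : W) (g : Reg → Sym) (q : Blk) : Blk := Stmt.push (Γ := Alph) (.wk i) g q
/-- Pop a symbol from a work stack. -/
def pop (i : W) (g : Reg → Option Sym → Reg) (q : Blk) : Blk := Stmt.pop (Γ := Alph) (.wk i) g q
/-- Read the top of a work stack. -/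
def peek (i : W) (g : Reg → Option Sym → Reg) (q : Blk) : Blk := Stmt.peek (Γ := Alph) (.wk i) g q
/-- Change the registers. -/
def load (g : Reg → Reg) (q : Blk) : Blk := Stmt.load g q
/-- Branch on a condition. -/
def branch (g : Reg → Bool) (q₁ q₂ : Blk) : Blk := Stmt.branch g q₁ q₂
/-- The end of a block. -/
def done : Blk := Stmt.goto fun _ => ()

section Exec

variable (i : W) (r : Reg) (T : W → List Sym)

/-- Moves updates from the dependent family of all stacks to the plain function `T`, so that effects
of blocks can be computed by `simp` on `tp`. -/
theorem update_full (l : List Sym) :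
    (Function.update (full T) (.wk i) l : ∀ k, List (Alph k)) = full (Function.update T i l) := by
  funext k
  rcases k with _ | _ | j
  · rfl
  · rfl
  · by_cases h : j = i
    · subst h
      exact (Function.update_self _ _ _).trans (Function.update_self j l T).symm
    · change _ = Function.update T i l j
      rw [Function.update_of_ne h]
      exact Function.update_of_ne (by simpa using h) _ _

@[simp] theorem exec_push (g : Reg → Sym) (q : Blk) :
    exec (push i g q) (r, full T) = exec q (r, full (Function.update T i (g r :: T i))) := by
  rw [← update_full]; rfl

@[simp] theorem exec_pop (g : Reg → Option Sym → Reg) (q : Blk) :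
    exec (pop i g q) (r, full T) =
      exec q (g r (T i).head?, full (Function.update T i (T i).tail)) := by
  rw [← update_full]; rfl

@[simp] theorem exec_peek (g : Reg → Option Sym → Reg) (q : Blk) :
    exec (peek i g q) (r, full T) = exec q (g r (T i).head?, full T) := rfl

@[simp] theorem exec_load (g : Reg → Reg) (q : Blk) (S : ∀ k, List (Alph k)) :
    exec (load g q) (r, S) = exec q (g r, S) := rfl

@[simp] theorem exec_branch (g : Reg → Bool) (q q' : Blk) (S : ∀ k, List (Alph k)) :
    exec (branch g q q') (r, S) = if g r then exec q (r, S) else exec q' (r, S) := by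
  cases h : g r <;> simp [branch, exec, h]

@[simp] theorem exec_done (S : Reg × ∀ k, List (Alph k)) : exec done S = S := rfl

end Exec

/-- `P` takes the contents `T` of the work stacks to `T'` in at most `n` steps, whatever the
registers are. -/
def RunW (P : Program) (T T' : W → List Sym) (n : ℕ) : Prop :=
  ∀ r : Reg, ∃ r' t, t ≤ n ∧ Run P (r, full T) t (r', full T')

namespace RunW

variable {P Q : Program} {T T' T'' : W → List Sym} {n m : ℕ}

theorem mono (h : RunW P T T' n) (hn : n ≤ m) : RunW P T T' m := fun r =>
  let ⟨r', t, ht, hr⟩ := h r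
  ⟨r', t, ht.trans hn, hr⟩

theorem seq (h : RunW P T T' n) (h' : RunW Q T' T'' m) : RunW (.seq P Q) T T'' (n + m) := by
  intro r
  obtain ⟨r', t, ht, hr⟩ := h r
  obtain ⟨r'', t', ht', hr'⟩ := h' r'
  exact ⟨r'', t + t', by omega, hr.seq hr'⟩

theorem blk {s : Blk} (h : ∀ r, ∃ r', exec s (r, full T) = (r', full T')) :
    RunW (.blk s) T T' 1 := by
  intro r
  obtain ⟨r', h⟩ := h r
  exact ⟨r', 1, le_rfl, h ▸ Run.blk s _⟩

end RunW

/-- Branch on the top of a stack. -/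
def iteTop (i : W) (c : Option Sym → Bool) (P Q : Program) : Program :=
  .seq (.blk (peek i (fun r s => (s, r.2)) done)) (.ite (fun r => c r.1) P Q)

/-- Repeat a program while the top of a stack satisfies a condition. -/
def loopTop (i : W) (c : Option Sym → Bool) (P : Program) : Program :=
  .loop (.seq P (.blk (peek i (fun r s => (s, r.2)) done))) (fun r => c r.1)

section Tops

variable {i : W} {c : Option Sym → Bool} {P Q : Program} {T T' T'' : W → List Sym} {n m : ℕ}

theorem RunW.iteTop_true (hc : c (T i).head? = true) (h : RunW P T T' n) :
    RunW (iteTop i c P Q) T T' (n + 2) := by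
  intro r
  obtain ⟨r', t, ht, hr⟩ := h ((T i).head?, r.2)
  exact ⟨r', 1 + (t + 1), by omega, (Run.blk _ _).seq (.iteTrue (by simpa using hc) (by simpa using hr))⟩

theorem RunW.iteTop_false (hc : c (T i).head? = false) (h : RunW Q T T' n) :
    RunW (iteTop i c P Q) T T' (n + 2) := by
  intro r
  obtain ⟨r', t, ht, hr⟩ := h ((T i).head?, r.2)
  exact ⟨r', 1 + (t + 1), by omega, (Run.blk _ _).seq (.iteFalse (by simpa using hc) (by simpa using hr))⟩

theorem RunW.loopTop_done (h : RunW P T T' n) (hc : c (T' i).head? = false) :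
    RunW (loopTop i c P) T T' (n + 2) := by
  intro r
  obtain ⟨r', t, ht, hr⟩ := h r
  refine ⟨((T' i).head?, r'.2), t + 1 + 1, by omega, .loopDone (.seq hr ?_) hc⟩
  exact Run.blk _ _

theorem RunW.loopTop_more (h : RunW P T T' n) (hc : c (T' i).head? = true)
    (h' : RunW (loopTop i c P) T' T'' m) : RunW (loopTop i c P) T T'' (n + 2 + m) := by
  intro r
  obtain ⟨r', t, ht, hr⟩ := h r
  obtain ⟨r'', t', ht', hr'⟩ := h' ((T' i).head?, r'.2)
  refine ⟨r'', t + 1 + 1 + t', by omega, .loopMore (.seq hr ?_) hc hr'⟩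
  exact Run.blk _ _

end Tops

/-- Each pass of a loop around a block costs two steps: the block and the test. -/
theorem Run.loop_blk_done {s : Blk} {c : Reg → Bool} {S S' : Reg × ∀ k, List (Alph k)}
    (h : exec s S = S') (hc : c S'.1 = false) : Run (.loop (.blk s) c) S 2 S' :=
  .loopDone (h ▸ .blk s S) hc

theorem Run.loop_blk_more {s : Blk} {c : Reg → Bool} {S S' S'' : Reg × ∀ k, List (Alph k)} {t : ℕ}
    (h : exec s S = S') (hc : c S'.1 = true) (h' : Run (.loop (.blk s) c) S' t S'') :
    Run (.loop (.blk s) c) S (t + 2) S'' :=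
  (show 1 + 1 + t = t + 2 by omega) ▸ Run.loopMore (h ▸ .blk s S) hc h'

/-- Move everything from one stack to another. -/
def moveAll (i j : W) : Program :=
  .loop (.blk (pop i (fun r s => (s, r.2))
    (branch (fun r => r.1.isSome) (push j (fun r => r.1.getD .cut) done) done)))
    fun r => r.1.isSome

/-- The final contents are a variable with an equation, so that uses can state them in `tp` form and
leave the equation to `simp`. -/
theorem runW_moveAll {i j : W} (hij : i ≠ j) {T T' : W → List Sym}
    (h : T' = Function.update (Function.update T i []) j ((T i).reverse ++ T j)) :
    RunW (moveAll i j) T T' (2 * (T i).length + 2) := by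
  suffices H : ∀ (l m : List Sym) (T : W → List Sym) (r : Reg), T i = l → T j = m → 
      ∃ r', Run (moveAll i j) (r, full T) (2 * l.length + 2)
        (r', full (Function.update (Function.update T i []) j (l.reverse ++ m))) by
    intro r
    obtain ⟨r', hr⟩ := H _ _ T r rfl rfl
    exact ⟨r', _, le_rfl, h ▸ hr⟩
  intro l
  induction l with
  | nil =>
    intro m T r h₁ h₂
    refine ⟨(none, r.2), .loop_blk_done ?_ rfl⟩
    simp [h₁, ← h₂, Function.update_comm hij]
  | cons x l ih =>
    intro m T r h₁ h₂
    obtain ⟨r', hr⟩ := ih (x :: m) (Function.update (Function.update T i l) j (x :: m)) (some x, r.2)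
      (by simp [hij]) (by simp)
    refine ⟨r', ?_⟩
    have e : Function.update (Function.update (Function.update (Function.update T i l) j (x :: m)) i [])
        j (l.reverse ++ x :: m) = Function.update (Function.update T i []) j ((x :: l).reverse ++ m) := by
      funext k
      by_cases hk : k = j
      · subst hk; simp
      · by_cases hi : k = i
        · subst hi; simp [hk]
        · simp [hk, hi]
    rw [e] at hr
    refine .loop_blk_more (S' := (_, _)) ?_ ?_ hr
    · simp [h₁, h₂, Function.update_of_ne hij.symm]
    · rfl

/-- Empty a stack. -/
def clear (i : W) : Program :=
  .loop (.blk (pop i (fun r s => (s, r.2)) done)) fun r => r.1.isSome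

theorem runW_clear {i : W} {T T' : W → List Sym} (h : T' = Function.update T i []) :
    RunW (clear i) T T' (2 * (T i).length + 2) := by
  suffices H : ∀ (l : List Sym) (T : W → List Sym) (r : Reg), T i = l → 
      ∃ r', Run (clear i) (r, full T) (2 * l.length + 2) (r', full (Function.update T i [])) by
    intro r
    obtain ⟨r', hr⟩ := H _ T r rfl
    exact ⟨r', _, le_rfl, h ▸ hr⟩
  intro l
  induction l with
  | nil =>
    intro T r h₁
    refine ⟨(none, r.2), .loop_blk_done ?_ rfl⟩
    simp [h₁]
  | cons x l ih =>
    intro T r h₁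
    obtain ⟨r', hr⟩ := ih (Function.update T i l) (some x, r.2) (by simp)
    rw [Function.update_idem] at hr
    refine ⟨r', .loop_blk_more (S' := (_, _)) ?_ ?_ hr⟩
    · simp [h₁]
    · rfl

/-- Move everything from the stack `b` to the stacks `a` and `c`. -/
def fork : Program :=
  .loop (.blk (pop .b (fun r s => (s, r.2))
    (branch (fun r => r.1.isSome)
      (push .a (fun r => r.1.getD .cut) (push .c (fun r => r.1.getD .cut) done)) done)))
    fun r => r.1.isSome

theorem runW_fork (a b c d e f u : List Sym) :
    RunW fork (tp a b c d e f u) (tp (b.reverse ++ a) [] (b.reverse ++ c) d e f u)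
      (2 * b.length + 2) := by
  intro r
  suffices H : ∃ r', Run fork (r, full (tp a b c d e f u)) (2 * b.length + 2)
      (r', full (tp (b.reverse ++ a) [] (b.reverse ++ c) d e f u)) by
    obtain ⟨r', hr⟩ := H
    exact ⟨r', _, le_rfl, hr⟩
  induction b generalizing a c r with
  | nil =>
    refine ⟨(none, r.2), .loop_blk_done ?_ rfl⟩
    simp
  | cons x l ih =>
    obtain ⟨r', hr⟩ := ih (x :: a) (x :: c) (some x, r.2)
    have e (y : List Sym) : l.reverse ++ x :: y = (x :: l).reverse ++ y := by simp
    rw [e, e] at hr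
    refine ⟨r', .loop_blk_more (S' := (_, _)) ?_ ?_ hr⟩
    · simp
    · rfl

end StackProg

/-! ### Trees on the main stack and the programs that rearrange, combine and fold them. -/

namespace StackProg

open Turing Turing.TM2

/-- The data on which programs operate: binary trees of strings. -/
inductive V : Type
  | atom (s : List RatSym)
  | pair (v w : V)

namespace V

/-- A tree as a string of stack symbols, in prefix order. -/
def enc : V → List Sym
  | atom s => s.map .chr ++ [.cut]
  | pair v w => .mark :: (v.enc ++ w.enc)

/-- The length of a tree, as a string. -/
def size (v : V) : ℕ := v.enc.length

/-- The number of inner nodes of a tree. -/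
def nodes : V → ℕ
  | atom _ => 0
  | pair v w => v.nodes + w.nodes + 1

/-- A list of trees, as a tree. -/
def list : List V → V
  | [] => atom []
  | v :: l => pair v (list l)

theorem length_enc (v : V) : v.enc.length = v.size := rfl

@[simp] theorem size_atom (s : List RatSym) : (atom s).size = s.length + 1 := by
  simp [size, enc]

@[simp] theorem size_pair (v w : V) : (pair v w).size = v.size + w.size + 1 := by
  simp [size, enc]

end V

open V

/-- The work stacks when only the main stack is in use. -/
def st (l : List Sym) : W → List Sym := tp l [] [] [] [] [] []

/-- Does a symbol begin a pair? -/
def isMark : Option Sym → Bool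
  | some .mark => true
  | _ => false

/-- Does a symbol end an atom? -/
def isStop : Option Sym → Bool
  | some (.chr _) => false
  | some .mark => false
  | _ => true

/-- Move one tree from the stack `a` to the stack `b`, reversing its string. The stack `u` counts
the trees that are still to be moved. -/
def takeLoop : Program :=
  .loop (.blk (peek .u (fun r s => (r.1, s, r.2.2)) (branch (fun r => r.2.1.isSome)
      (pop .a (fun r s => (s, r.2)) (push .b (fun r => r.1.getD .cut)
        (branch (fun r => isMark r.1) (push .u (fun _ => .mark) done)
          (branch (fun r => isStop r.1) (pop .u (fun r _ => r) done) done)))) done)))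
    fun r => r.2.1.isSome

/-- A `mark` replaces one pending tree by two, a `cut` finishes one; this is what the stack `u`
records. The statement is in continuation form: the rest of the run, after `v` has been moved, is
the hypothesis `h`. In the case of a pair, the run on the second component then serves as the
continuation for the first. -/
theorem run_takeLoop (v : V) (a b c d e f u : List Sym) (t : ℕ) (T : W → List Sym)
    (h : ∀ r, ∃ r', Run takeLoop (r, full (tp a (v.enc.reverse ++ b) c d e f u)) t (r', full T))
    (r : Reg) :
    ∃ r', Run takeLoop (r, full (tp (v.enc ++ a) b c d e f (.mark :: u))) (t + 2 * v.size)
      (r', full T) := by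
  induction v generalizing a b u t r with
  | atom s =>
    induction s generalizing b r with
    | nil =>
      obtain ⟨r', hr⟩ := h (some .cut, some .mark, r.2.2)
      refine ⟨r', .loop_blk_more (S' := (_, _)) ?_ ?_ hr⟩
      · simp [enc, isMark, isStop]
      · rfl
    | cons x s ih =>
      obtain ⟨r', hr⟩ := ih (.chr x :: b) (by simpa [enc] using h) (some (.chr x), some .mark, r.2.2)
      rw [size_atom] at hr ⊢
      rw [show t + 2 * ((x :: s).length + 1) = t + 2 * (s.length + 1) + 2 by simp; omega]
      refine ⟨r', .loop_blk_more (S' := (_, _)) ?_ ?_ hr⟩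
      · simp [enc, isMark, isStop]
      · rfl
  | pair v w ihv ihw =>
    have hw := ihw a (v.enc.reverse ++ (.mark :: b)) u t (by simpa [enc] using h)
    obtain ⟨r', hr⟩ := ihv (w.enc ++ a) (.mark :: b) (.mark :: u) _ hw (some .mark, some .mark, r.2.2)
    rw [size_pair, show t + 2 * (v.size + w.size + 1) = t + 2 * w.size + 2 * v.size + 2 by omega]
    refine ⟨r', .loop_blk_more (S' := (_, _)) ?_ ?_ hr⟩
    · simp [enc, isMark]
    · rfl

/-- Move one tree from the stack `a` to the stack `b`, reversing its string. -/
def take : Program := .seq (.blk (push .u (fun _ => .mark) done)) takeLoop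

theorem runW_take (v : V) (a b c d e f : List Sym) :
    RunW take (tp (v.enc ++ a) b c d e f []) (tp a (v.enc.reverse ++ b) c d e f [])
      (2 * v.size + 3) := by
  refine RunW.mono (n := 1 + (2 + 2 * v.size)) (RunW.seq (T' := tp (v.enc ++ a) b c d e f [.mark])
    (.blk fun r => ⟨r, by simp⟩) ?_) (by omega)
  intro r
  obtain ⟨r', hr⟩ := run_takeLoop v a b c d e f [] 2 _
    (fun r => ⟨(r.1, none, r.2.2), .loop_blk_done (S' := (_, full (tp a (v.enc.reverse ++ b) c d e f []))) (by simp) rfl⟩) r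
  exact ⟨r', _, le_rfl, hr⟩

/-- Duplicate the tree on top of the main stack. -/
def dup : Program := .seq take (.seq fork (.seq (moveAll .c .b) (moveAll .b .a)))

/-- Every move reverses a string, so each tree has to be moved an even number of times; hence the
detour of the second copy through `b`. The same parity governs `swap` and `rotate`. -/
theorem runW_dup (v : V) (a : List Sym) :
    RunW dup (st (v.enc ++ a)) (st (v.enc ++ (v.enc ++ a))) (8 * v.size + 9) := by
  have h₁ := runW_take v a [] [] [] [] []
  have h₂ := runW_fork a v.enc.reverse [] [] [] [] []
  have h₃ : RunW (moveAll .c .b) (tp (v.enc ++ a) [] v.enc [] [] [] [])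
    (tp (v.enc ++ a) v.enc.reverse [] [] [] [] []) _ := runW_moveAll (by decide) (by simp)
  have h₄ : RunW (moveAll .b .a) (tp (v.enc ++ a) v.enc.reverse [] [] [] [] [])
    (st (v.enc ++ (v.enc ++ a))) _ := runW_moveAll (by decide) (by simp [st])
  simp only [List.append_nil, List.reverse_reverse] at h₁ h₂
  refine (h₁.seq (h₂.seq (h₃.seq h₄))).mono ?_
  simp [length_enc]; omega

/-- Exchange the two trees on top of the main stack. -/
def swap : Program :=
  .seq take (.seq (moveAll .b .c) (.seq take
    (.seq (moveAll .c .d) (.seq (moveAll .d .a) (moveAll .b .a)))))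

theorem runW_swap (v w : V) (a : List Sym) :
    RunW swap (st (v.enc ++ (w.enc ++ a))) (st (w.enc ++ (v.enc ++ a)))
      (8 * v.size + 4 * w.size + 14) := by
  have h₁ := runW_take v (w.enc ++ a) [] [] [] [] []
  have h₂ : RunW (moveAll .b .c) (tp (w.enc ++ a) v.enc.reverse [] [] [] [] [])
    (tp (w.enc ++ a) [] v.enc [] [] [] []) _ := runW_moveAll (by decide) (by simp)
  have h₃ := runW_take w a [] v.enc [] [] []
  have h₄ : RunW (moveAll .c .d) (tp a w.enc.reverse v.enc [] [] [] [])
    (tp a w.enc.reverse [] v.enc.reverse [] [] []) _ := runW_moveAll (by decide) (by simp)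
  have h₅ : RunW (moveAll .d .a) (tp a w.enc.reverse [] v.enc.reverse [] [] [])
    (tp (v.enc ++ a) w.enc.reverse [] [] [] [] []) _ := runW_moveAll (by decide) (by simp)
  have h₆ : RunW (moveAll .b .a) (tp (v.enc ++ a) w.enc.reverse [] [] [] [] [])
    (st (w.enc ++ (v.enc ++ a))) _ := runW_moveAll (by decide) (by simp [st])
  simp only [List.append_nil] at h₁ h₃
  refine (h₁.seq (h₂.seq (h₃.seq (h₄.seq (h₅.seq h₆))))).mono ?_
  simp [length_enc]; omega

/-- Remove the tree on top of the main stack. -/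
def drop : Program := .seq take (clear .b)

theorem runW_drop (v : V) (a : List Sym) :
    RunW drop (st (v.enc ++ a)) (st a) (4 * v.size + 5) := by
  have h₁ := runW_take v a [] [] [] [] []
  have h₂ : RunW (clear .b) (tp a v.enc.reverse [] [] [] [] []) (st a) _ :=
    runW_clear (by simp [st])
  simp only [List.append_nil] at h₁
  refine (h₁.seq h₂).mono ?_
  simp [length_enc]; omega

/-- Remove the top symbol of the main stack. -/
def unmark : Program := .blk (pop .a (fun r _ => r) done)

theorem runW_unmark (x : Sym) (b : List Sym) : RunW unmark (st (x :: b)) (st b) 1 :=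
  .blk fun r => ⟨r, by simp [st]⟩

/-- Begin a pair. -/
def putMark : Program := .blk (push .a (fun _ => .mark) done)

theorem runW_putMark (b : List Sym) : RunW putMark (st b) (st (.mark :: b)) 1 :=
  .blk fun r => ⟨r, by simp [st]⟩

/-- The program that does nothing. -/
def skip : Program := .blk done

theorem runW_skip (T : W → List Sym) : RunW skip T T 1 := .blk fun r => ⟨r, rfl⟩

/-- `P` replaces the tree `v` on top of the main stack by `w`, in at most `n` steps. -/
def Realizes (P : Program) (v w : V) (n : ℕ) : Prop :=
  ∀ a, RunW P (st (v.enc ++ a)) (st (w.enc ++ a)) n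

/-- The program that computes the pair of the results of two programs. -/
def pairProg (P Q : Program) : Program :=
  .seq dup (.seq P (.seq swap (.seq Q (.seq swap putMark))))

/-- The program that runs `Q` or `R`, according to the result of `P`. -/
def iteProg (P Q R : Program) : Program :=
  .seq dup (.seq P (iteTop .a (fun s => !isStop s) (.seq drop Q) (.seq drop R)))

namespace Realizes

variable {P Q R : Program} {u v w x y : V} {k n m : ℕ}

theorem mono (h : Realizes P v w n) (hn : n ≤ m) : Realizes P v w m := fun a => (h a).mono hn

theorem seq (h : Realizes P u v n) (h' : Realizes Q v w m) : Realizes (.seq P Q) u w (n + m) :=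
  fun a => (h a).seq (h' a)

theorem skip : Realizes skip v v 1 := fun _ => runW_skip _

theorem fst : Realizes (.seq unmark (.seq swap drop)) (pair v w) v (8 * v.size + 8 * w.size + 20) := by
  intro a
  have h := (runW_unmark .mark (v.enc ++ (w.enc ++ a))).seq
    ((runW_swap v w a).seq (runW_drop w (v.enc ++ a)))
  simpa [enc] using h.mono (by omega)

theorem snd : Realizes (.seq unmark drop) (pair v w) w (4 * v.size + 6) := by
  intro a
  have h := (runW_unmark .mark (v.enc ++ (w.enc ++ a))).seq (runW_drop v (w.enc ++ a))
  simpa [enc] using h.mono (by omega)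

/-- `Realizes` allows any contents below the tree: `P` runs on a copy of `v` with `v` underneath,
then `Q` runs on `v` with `x` underneath. The lengths of `x` and `y` enter the cost through the two
exchanges. -/
theorem pair (h : Realizes P v x n) (h' : Realizes Q v y m) :
    Realizes (pairProg P Q) v (pair x y)
      (n + m + 12 * v.size + 12 * x.size + 8 * y.size + 38) := by
  intro a
  have h := (runW_dup v a).seq ((h _).seq ((runW_swap x v a).seq ((h' _).seq
    ((runW_swap y x a).seq (runW_putMark _)))))
  simpa [enc, pairProg] using h.mono (by omega)

/-- One symbol decides the test. The only tree whose string begins with `cut` is the empty atom,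
which will represent `false`, the empty list and `none`. -/
theorem iteTrue (h : Realizes P v x n) (hx : isStop x.enc.head? = false) (h' : Realizes Q v y m) :
    Realizes (iteProg P Q R) v y
      (n + m + 8 * v.size + 4 * x.size + 16) := by
  intro a
  have e : (st (x.enc ++ (v.enc ++ a)) .a).head? = x.enc.head? := by
    cases x with
    | atom s => cases s <;> rfl
    | pair => rfl
  have h := (runW_dup v a).seq ((h _).seq (RunW.iteTop_true (i := .a) (c := fun s => !isStop s)
    (Q := .seq drop R) (by simp [e, hx]) ((runW_drop x (v.enc ++ a)).seq (h' a))))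
  exact h.mono (by omega)

theorem iteFalse (h : Realizes P v x n) (hx : isStop x.enc.head? = true) (h' : Realizes R v y m) :
    Realizes (iteProg P Q R) v y
      (n + m + 8 * v.size + 4 * x.size + 16) := by
  intro a
  have e : (st (x.enc ++ (v.enc ++ a)) .a).head? = x.enc.head? := by
    cases x with
    | atom s => cases s <;> rfl
    | pair => rfl
  have h := (runW_dup v a).seq ((h _).seq (RunW.iteTop_false (i := .a) (c := fun s => !isStop s)
    (P := .seq drop Q) (by simp [e, hx]) ((runW_drop x (v.enc ++ a)).seq (h' a))))
  exact h.mono (by omega)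

end Realizes

/-- Push a string on the main stack. -/
def pushes : List Sym → Blk
  | [] => done
  | x :: l => push .a (fun _ => x) (pushes l)

theorem exec_pushes (l a : List Sym) (r : Reg) :
    exec (pushes l) (r, full (st a)) = (r, full (st (l.reverse ++ a))) := by
  induction l generalizing a with
  | nil => rfl
  | cons x l ih => simpa [pushes, st] using ih (x :: a)

theorem Realizes.const (v w : V) :
    Realizes (.seq drop (.blk (pushes w.enc.reverse))) v w (4 * v.size + 6) := fun a =>
  (runW_drop v a).seq (.blk fun r => ⟨r, by simp [exec_pushes]⟩)

/-- `rotate` replaces the trees `v, w, x` on top of the main stack by `x, v, w`. -/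
def rotate : Program :=
  .seq take (.seq (moveAll .b .c) (.seq take (.seq (moveAll .b .d) (.seq take
    (.seq (moveAll .d .e) (.seq (moveAll .e .a) (.seq (moveAll .c .e) (.seq (moveAll .e .a)
      (moveAll .b .a)))))))))

theorem runW_rotate (v w x : V) (a : List Sym) :
    RunW rotate (st (v.enc ++ (w.enc ++ (x.enc ++ a)))) (st (x.enc ++ (v.enc ++ (w.enc ++ a))))
      (8 * v.size + 8 * w.size + 4 * x.size + 23) := by
  have h₁ := runW_take v (w.enc ++ (x.enc ++ a)) [] [] [] [] []
  have h₂ : RunW (moveAll .b .c) (tp (w.enc ++ (x.enc ++ a)) v.enc.reverse [] [] [] [] [])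
    (tp (w.enc ++ (x.enc ++ a)) [] v.enc [] [] [] []) _ := runW_moveAll (by decide) (by simp)
  have h₃ := runW_take w (x.enc ++ a) [] v.enc [] [] []
  have h₄ : RunW (moveAll .b .d) (tp (x.enc ++ a) w.enc.reverse v.enc [] [] [] [])
    (tp (x.enc ++ a) [] v.enc w.enc [] [] []) _ := runW_moveAll (by decide) (by simp)
  have h₅ := runW_take x a [] v.enc w.enc [] []
  have h₆ : RunW (moveAll .d .e) (tp a x.enc.reverse v.enc w.enc [] [] [])
    (tp a x.enc.reverse v.enc [] w.enc.reverse [] []) _ := runW_moveAll (by decide) (by simp)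
  have h₇ : RunW (moveAll .e .a) (tp a x.enc.reverse v.enc [] w.enc.reverse [] [])
    (tp (w.enc ++ a) x.enc.reverse v.enc [] [] [] []) _ := runW_moveAll (by decide) (by simp)
  have h₈ : RunW (moveAll .c .e) (tp (w.enc ++ a) x.enc.reverse v.enc [] [] [] [])
    (tp (w.enc ++ a) x.enc.reverse [] [] v.enc.reverse [] []) _ :=
    runW_moveAll (by decide) (by simp)
  have h₉ : RunW (moveAll .e .a) (tp (w.enc ++ a) x.enc.reverse [] [] v.enc.reverse [] [])
    (tp (v.enc ++ (w.enc ++ a)) x.enc.reverse [] [] [] [] []) _ :=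
    runW_moveAll (by decide) (by simp)
  have h₁₀ : RunW (moveAll .b .a) (tp (v.enc ++ (w.enc ++ a)) x.enc.reverse [] [] [] [] [])
    (st (x.enc ++ (v.enc ++ (w.enc ++ a)))) _ := runW_moveAll (by decide) (by simp [st])
  simp only [List.append_nil] at h₁ h₃ h₅
  refine (h₁.seq (h₂.seq (h₃.seq (h₄.seq (h₅.seq (h₆.seq (h₇.seq (h₈.seq (h₉.seq h₁₀))))))))).mono ?_
  simp [length_enc]; omega

/-- `Folds P v l w n`: folding the operation realized by `P` over the list `l`, starting from `v`,
gives `w`. The number of steps is at most `n`. -/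
inductive Folds (P : Program) : V → List V → V → ℕ → Prop
  | nil (v : V) : Folds P v [] v 0
  | cons {v v' w x : V} {l : List V} {n m : ℕ} : Realizes P (pair v x) v' n → Folds P v' l w m →
      Folds P v (x :: l) w
        (n + m + 8 * x.size + 12 * (V.list l).size + 4 * v.size + 8 * v'.size + 41)

/-- One step of a fold, on the rest of the list and the accumulated value. -/
def foldStep (P : Program) : Program :=
  .seq unmark (.seq rotate (.seq putMark (.seq P swap)))

/-- Fold an operation over a list. -/
def fold (P : Program) : Program :=
  .seq unmark (.seq swap (.seq (iteTop .a isMark (loopTop .a isMark (foldStep P)) skip) drop))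

/-- Without its mark, the list leaves its head `x` and tail `y` above the accumulator `v`. The
rotation brings `v` to the top, and putting the mark back makes `v`, `x` the pair to which `P`
applies. -/
theorem runW_foldStep {P : Program} {v v' x y : V} {n : ℕ} (h : Realizes P (pair v x) v' n)
    (a : List Sym) :
    RunW (foldStep P) (st ((pair x y).enc ++ (v.enc ++ a))) (st (y.enc ++ (v'.enc ++ a)))
      (n + 8 * x.size + 12 * y.size + 4 * v.size + 8 * v'.size + 39) := by
  have h' := (runW_unmark .mark (x.enc ++ (y.enc ++ (v.enc ++ a)))).seq
    ((runW_rotate x y v a).seq ((runW_putMark _).seq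
      ((show RunW P (st (.mark :: (v.enc ++ (x.enc ++ (y.enc ++ a))))) _ _ by
        simpa [enc] using h (y.enc ++ a)).seq (runW_swap v' y a))))
  simpa [enc, foldStep] using h'.mono (by omega)

/-- The loop tests after its body, so the list must be nonempty here; the empty list is caught by
the `iteTop` in `fold`. -/
theorem Folds.runW {P : Program} {v w : V} {l : List V} {n : ℕ} (h : Folds P v l w n)
    (hl : l ≠ []) (a : List Sym) :
    RunW (loopTop .a isMark (foldStep P)) (st ((V.list l).enc ++ (v.enc ++ a)))
      (st ((V.list []).enc ++ (w.enc ++ a))) n := by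
  induction h with
  | nil => exact absurd rfl hl
  | @cons v v' w x l n m h h' ih =>
    have hs := runW_foldStep (y := V.list l) h a
    cases l with
    | nil =>
      cases h'
      exact (RunW.loopTop_done hs rfl).mono (by omega)
    | cons y l => exact (RunW.loopTop_more hs rfl (ih (by simp))).mono (by omega)

theorem Realizes.fold {P : Program} {v w : V} {l : List V} {n : ℕ} (h : Folds P v l w n) :
    Realizes (fold P) (.pair v (V.list l)) w (n + 8 * v.size + 4 * (V.list l).size + 30) := by
  intro a
  have h₃ := runW_drop (V.list []) (w.enc ++ a)
  have e : (V.list []).size = 1 := rfl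
  have h₂ : RunW (iteTop .a isMark (loopTop .a isMark (foldStep P)) StackProg.skip)
      (st ((V.list l).enc ++ (v.enc ++ a))) (st ((V.list []).enc ++ (w.enc ++ a))) (n + 3) := by
    cases l with
    | nil =>
      cases h
      exact (RunW.iteTop_false rfl (runW_skip _)).mono (by omega)
    | cons y l => exact (RunW.iteTop_true rfl (h.runW (by simp) a)).mono (by omega)
  intro r
  obtain ⟨r', t, ht, hr⟩ := (runW_unmark .mark (v.enc ++ ((V.list l).enc ++ a))).seq
    ((runW_swap v (V.list l) a).seq (h₂.seq h₃)) r
  exact ⟨r', t, by omega, by simpa [enc, StackProg.fold] using hr⟩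

end StackProg

/-! ### Programs for strings and for binary addition, multiplication and comparison. -/

namespace StackProg

open Turing Turing.TM2 V

/-- Move an atom from the stack `a` to the stack `b`, without the symbol that ends it. -/
def takeAtom : Program :=
  .loop (.blk (pop .a (fun r s => (s, r.2)) (branch (fun r => isStop r.1) done
    (push .b (fun r => r.1.getD .cut) done)))) fun r => !isStop r.1

theorem runW_takeAtom (s : List RatSym) (a b c d e f u : List Sym) :
    RunW takeAtom (tp ((atom s).enc ++ a) b c d e f u)
      (tp a ((s.map .chr).reverse ++ b) c d e f u) (2 * s.length + 2) := by
  intro r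
  suffices H : ∃ r', Run takeAtom (r, full (tp ((atom s).enc ++ a) b c d e f u))
      (2 * s.length + 2) (r', full (tp a ((s.map .chr).reverse ++ b) c d e f u)) by
    obtain ⟨r', hr⟩ := H
    exact ⟨r', _, le_rfl, hr⟩
  induction s generalizing b r with
  | nil =>
    refine ⟨(some .cut, r.2), .loop_blk_done ?_ rfl⟩
    simp [enc, isStop]
  | cons x s ih =>
    obtain ⟨r', hr⟩ := ih (.chr x :: b) (some (.chr x), r.2)
    have e : ((x :: s).map Sym.chr).reverse ++ b = (s.map Sym.chr).reverse ++ .chr x :: b := by simp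
    rw [e]
    refine ⟨r', .loop_blk_more (S' := (_, _)) ?_ ?_ hr⟩
    · simp [enc, isStop]
    · rfl

/-- Does a symbol belong to the class `q` of input symbols? -/
def inClass (q : RatSym → Bool) : Option Sym → Bool
  | some (.chr x) => q x
  | _ => false

/-- Move the longest prefix with symbols in `q` from the stack `a` to the stack `b`. -/
def takePrefix (q : RatSym → Bool) : Program :=
  .loop (.blk (peek .a (fun r s => (s, r.2)) (branch (fun r => inClass q r.1)
    (pop .a (fun r _ => r) (push .b (fun r => r.1.getD .cut) done)) done))) fun r => inClass q r.1

theorem runW_takePrefix (q : RatSym → Bool) (s : List RatSym) (a b c d e f u : List Sym) :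
    RunW (takePrefix q) (tp ((atom s).enc ++ a) b c d e f u)
      (tp ((atom (s.dropWhile q)).enc ++ a) (((s.takeWhile q).map .chr).reverse ++ b) c d e f u)
      (2 * s.length + 2) := by
  intro r
  suffices H : ∃ r' t, t ≤ 2 * s.length + 2 ∧
      Run (takePrefix q) (r, full (tp ((atom s).enc ++ a) b c d e f u)) t
        (r', full (tp ((atom (s.dropWhile q)).enc ++ a)
          (((s.takeWhile q).map .chr).reverse ++ b) c d e f u)) from H
  induction s generalizing b r with
  | nil =>
    refine ⟨(some .cut, r.2), 2, le_add_self, .loop_blk_done ?_ rfl⟩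
    simp [enc, inClass]
  | cons x s ih =>
    cases hx : q x
    · refine ⟨(some (.chr x), r.2), 2, le_add_self, .loop_blk_done ?_ (by simpa [inClass] using hx)⟩
      simp [enc, inClass, hx]
    · obtain ⟨r', t, ht, hr⟩ := ih (.chr x :: b) (some (.chr x), r.2)
      have e : (((x :: s).takeWhile q).map Sym.chr).reverse ++ b =
        ((s.takeWhile q).map Sym.chr).reverse ++ .chr x :: b := by simp [hx]
      rw [e, List.dropWhile_cons_of_pos hx]
      refine ⟨r', t + 2, by simp; omega, .loop_blk_more (S' := (_, _)) ?_ ?_ hr⟩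
      · simp [enc, inClass, hx]
      · simpa [inClass] using hx

theorem Realizes.span (q : RatSym → Bool) (s : List RatSym) :
    Realizes (.seq (takePrefix q) (.seq (.blk (push .a (fun _ => .cut) done))
      (.seq (moveAll .b .a) putMark))) (.atom s)
      (.pair (.atom (s.takeWhile q)) (.atom (s.dropWhile q))) (4 * s.length + 6) := by
  intro a
  have hs : (s.takeWhile q).length ≤ s.length := (s.takeWhile_prefix q).length_le
  have h₁ := runW_takePrefix q s a [] [] [] [] [] []
  have h₂ : RunW (.blk (push .a (fun _ => .cut) done))
    (tp ((atom (s.dropWhile q)).enc ++ a) ((s.takeWhile q).map .chr).reverse [] [] [] [] [])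
    (tp (.cut :: ((atom (s.dropWhile q)).enc ++ a))
      ((s.takeWhile q).map .chr).reverse [] [] [] [] []) _ := .blk fun r => ⟨r, by simp⟩
  have h₃ : RunW (moveAll .b .a) (tp (.cut :: ((atom (s.dropWhile q)).enc ++ a))
      ((s.takeWhile q).map .chr).reverse [] [] [] [] [])
    (st ((atom (s.takeWhile q)).enc ++ ((atom (s.dropWhile q)).enc ++ a))) _ :=
    runW_moveAll (by decide) (by simp [st, enc])
  have h₄ := runW_putMark ((atom (s.takeWhile q)).enc ++ ((atom (s.dropWhile q)).enc ++ a))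
  simp only [List.append_nil] at h₁
  have h := h₁.seq (h₂.seq (h₃.seq h₄))
  rw [show (Sym.mark :: ((atom (s.takeWhile q)).enc ++ ((atom (s.dropWhile q)).enc ++ a))) =
    (V.pair (.atom (s.takeWhile q)) (.atom (s.dropWhile q))).enc ++ a by simp [enc]] at h
  exact h.mono (by simp; omega)

theorem Realizes.tail (s : List RatSym) :
    Realizes (.blk (peek .a (fun r s => (s, r.2)) (branch (fun r => isStop r.1) done
      (pop .a (fun r _ => r) done)))) (.atom s) (.atom s.tail) 1 := by
  intro a
  refine .blk fun r => ?_
  cases s with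
  | nil => exact ⟨(some .cut, r.2), by simp [st, enc, isStop]⟩
  | cons x s => exact ⟨(some (.chr x), r.2), by simp [st, enc, isStop]⟩

/-- A list of binary digits, as a string of stack symbols. -/
def bits (l : List Bool) : List Sym := l.map fun b => .chr (.bit b)

@[simp] theorem length_bits (l : List Bool) : (bits l).length = l.length := by simp [bits]

@[simp] theorem bits_nil : bits [] = [] := rfl

@[simp] theorem bits_cons (x : Bool) (l : List Bool) : bits (x :: l) = .chr (.bit x) :: bits l := rfl

theorem map_chr_bit (l : List Bool) : (l.map RatSym.bit).map Sym.chr = bits l := by simp [bits]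

/-- The number with the binary digits `l`, as a tree. -/
def num (l : List Bool) : V := .atom (l.map .bit)

@[simp] theorem size_num (l : List Bool) : (num l).size = l.length + 1 := by simp [num]

theorem enc_num (l : List Bool) : (num l).enc = bits l ++ [.cut] := by simp [num, enc, bits]

/-- Move a pair of numbers from the main stack to the stacks `d` and `e`. -/
def loadNums : Program :=
  .seq unmark (.seq takeAtom (.seq (moveAll .b .d) (.seq takeAtom (moveAll .b .e))))

theorem runW_loadNums (l m : List Bool) (a : List Sym) :
    RunW loadNums (st ((pair (num l) (num m)).enc ++ a)) (tp a [] [] (bits l) (bits m) [] [])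
      (4 * l.length + 4 * m.length + 9) := by
  have h₀ := runW_unmark .mark ((num l).enc ++ ((num m).enc ++ a))
  have h₁ := runW_takeAtom (l.map .bit) ((num m).enc ++ a) [] [] [] [] [] []
  have h₂ : RunW (moveAll .b .d) (tp ((num m).enc ++ a) (bits l).reverse [] [] [] [] [])
    (tp ((num m).enc ++ a) [] [] (bits l) [] [] []) _ := runW_moveAll (by decide) (by simp)
  have h₃ := runW_takeAtom (m.map .bit) a [] [] (bits l) [] [] []
  have h₄ : RunW (moveAll .b .e) (tp a (bits m).reverse [] (bits l) [] [] [])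
    (tp a [] [] (bits l) (bits m) [] []) _ := runW_moveAll (by decide) (by simp)
  simp only [List.append_nil, map_chr_bit] at h₁ h₃
  have h := h₀.seq (h₁.seq (h₂.seq (h₃.seq h₄)))
  rw [show Sym.mark :: ((num l).enc ++ ((num m).enc ++ a)) = (pair (num l) (num m)).enc ++ a by
    simp [enc]] at h
  exact h.mono (by simp; omega)

/-- The digit that a symbol stands for. -/
def digit : Option Sym → Bool
  | some (.chr (.bit b)) => b
  | _ => false

/-- The sum of three bits, modulo 2. -/
def xor3 (x y c : Bool) : Bool := x ^^ (y ^^ c)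

/-- The carry of the sum of three bits. -/
def maj3 (x y c : Bool) : Bool := (x && y) || (c && (x || y))

/-- Addition of binary numbers with carry. -/
def addBits : List Bool → List Bool → Bool → List Bool
  | [], [], false => []
  | [], [], true => [true]
  | x :: l, [], c => xor3 x false c :: addBits l [] (maj3 x false c)
  | [], y :: m, c => xor3 false y c :: addBits [] m (maj3 false y c)
  | x :: l, y :: m, c => xor3 x y c :: addBits l m (maj3 x y c)

/-- Add the numbers on the stacks `d` and `e`, reversing the sum to `c` and the number on `d` to
`f`. -/
def addLoop : Program :=
  .loop (.blk (pop .d (fun r s => (s, r.2)) (pop .e (fun r s => (r.1, s, r.2.2))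
    (branch (fun r => r.1.isSome || r.2.1.isSome || r.2.2)
      (branch (fun r => r.1.isSome)
        (push .f (fun r => r.1.getD .cut)
          (push .c (fun r => .chr (.bit (xor3 (digit r.1) (digit r.2.1) r.2.2)))
            (load (fun r => (some .cut, none, maj3 (digit r.1) (digit r.2.1) r.2.2)) done)))
        (push .c (fun r => .chr (.bit (xor3 (digit r.1) (digit r.2.1) r.2.2)))
          (load (fun r => (some .cut, none, maj3 (digit r.1) (digit r.2.1) r.2.2)) done)))
      done)))) fun r => r.1.isSome

/-- The lowest digits are on top of the stacks and the Boolean register is the carry. The first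
register signals whether to go on: `some .cut` after a digit has been produced, `none` when both
numbers and the carry are exhausted. The copy on `f` preserves the first summand, which
multiplication adds repeatedly. -/
theorem run_addLoop (l m : List Bool) (x : Bool) (r₁ r₂ : Option Sym) (a b c f : List Sym) :
    ∃ r' t, t ≤ 2 * l.length + 2 * m.length + 4 ∧
      Run addLoop ((r₁, r₂, x), full (tp a b c (bits l) (bits m) f [])) t
        (r', full (tp a b ((bits (addBits l m x)).reverse ++ c) [] [] ((bits l).reverse ++ f) [])) := by
  induction l, m, x using addBits.induct generalizing r₁ r₂ c f with
  | case1 =>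
    refine ⟨(none, none, false), 2, by simp, .loop_blk_done ?_ rfl⟩
    simp [addBits]
  | case2 =>
    refine ⟨(none, none, false), 4, by simp,
      .loop_blk_more (S' := ((some .cut, none, false), full (tp a b (.chr (.bit true) :: c) [] [] f [])))
        ?_ rfl (.loop_blk_done ?_ rfl)⟩
    · simp [digit, xor3, maj3]
    · simp [addBits]
  | case3 x l c' ih =>
    obtain ⟨r', t, ht, hr⟩ := ih (some .cut) none (.chr (.bit (xor3 x false c')) :: c)
      (.chr (.bit x) :: f)
    refine ⟨r', t + 2, by simp at ht ⊢; omega, .loop_blk_more (S' := (_, _)) ?_ rfl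
      (by simpa [addBits, addLoop] using hr)⟩
    simp [digit]
  | case4 y m c' ih =>
    obtain ⟨r', t, ht, hr⟩ := ih (some .cut) none (.chr (.bit (xor3 false y c')) :: c) f
    refine ⟨r', t + 2, by simp at ht ⊢; omega, .loop_blk_more (S' := (_, _)) ?_ rfl
      (by simpa [addBits, addLoop] using hr)⟩
    simp [digit]
  | case5 x l y m c' ih =>
    obtain ⟨r', t, ht, hr⟩ := ih (some .cut) none (.chr (.bit (xor3 x y c')) :: c)
      (.chr (.bit x) :: f)
    refine ⟨r', t + 2, by simp at ht ⊢; omega, .loop_blk_more (S' := (_, _)) ?_ rfl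
      (by simpa [addBits, addLoop] using hr)⟩
    simp [digit]

theorem length_addBits (l m : List Bool) (x : Bool) :
    (addBits l m x).length ≤ max l.length m.length + 1 := by
  induction l, m, x using addBits.induct <;> simp_all [addBits]

theorem binVal_cons (x : Bool) (l : List Bool) : binVal (x :: l) = x.toNat + 2 * binVal l := by
  simp [binVal, Nat.ofDigits_cons]

@[simp] theorem binVal_nil : binVal [] = 0 := rfl

theorem binVal_addBits (l m : List Bool) (x : Bool) :
    binVal (addBits l m x) = binVal l + binVal m + x.toNat := by
  induction l, m, x using addBits.induct with
  | case1 => simp [addBits]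
  | case2 => simp [addBits, binVal_cons]
  | case3 x l c ih =>
    rw [addBits, binVal_cons, ih, binVal_cons]
    cases x <;> cases c <;> simp [xor3, maj3] <;> omega
  | case4 y m c ih =>
    rw [addBits, binVal_cons, ih, binVal_cons]
    cases y <;> cases c <;> simp [xor3, maj3] <;> omega
  | case5 x l y m c ih =>
    rw [addBits, binVal_cons, ih, binVal_cons, binVal_cons]
    cases x <;> cases y <;> cases c <;> simp [xor3, maj3] <;> omega

/-- Add the number on the stack `d` to that on the stack `e`. -/
def addNums : Program :=
  .seq (.seq (.blk (load (fun _ => (none, none, false)) done)) addLoop)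
    (.seq (moveAll .c .e) (moveAll .f .d))

theorem runW_addNums (l m : List Bool) (a b : List Sym) :
    RunW addNums (tp a b [] (bits l) (bits m) [] [])
      (tp a b [] (bits l) (bits (addBits l m false)) [] []) (6 * l.length + 4 * m.length + 11) := by
  have h₁ : RunW (.seq (.blk (load (fun _ => (none, none, false)) done)) addLoop)
      (tp a b [] (bits l) (bits m) [] [])
      (tp a b (bits (addBits l m false)).reverse [] [] (bits l).reverse [])
      (2 * l.length + 2 * m.length + 5) := by
    intro r
    obtain ⟨r', t, ht, hr⟩ := run_addLoop l m false none none a b [] []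
    refine ⟨r', 1 + t, by omega, .seq (.blk _ _) ?_⟩
    simpa using hr
  have h₂ : RunW (moveAll .c .e) (tp a b (bits (addBits l m false)).reverse [] [] (bits l).reverse [])
    (tp a b [] [] (bits (addBits l m false)) (bits l).reverse []) _ :=
    runW_moveAll (by decide) (by simp)
  have h₃ : RunW (moveAll .f .d) (tp a b [] [] (bits (addBits l m false)) (bits l).reverse [])
    (tp a b [] (bits l) (bits (addBits l m false)) [] []) _ :=
    runW_moveAll (by decide) (by simp)
  have := length_addBits l m false
  exact (h₁.seq (h₂.seq h₃)).mono (by simp; omega)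

/-- Move the number on the stack `e` to the main stack, and empty the stack `d`. -/
def storeNum : Program :=
  .seq (clear .d) (.seq (.blk (push .a (fun _ => .cut) done)) (.seq (moveAll .e .b) (moveAll .b .a)))

theorem runW_storeNum (l m : List Bool) (a : List Sym) :
    RunW storeNum (tp a [] [] (bits l) (bits m) [] []) (st ((num m).enc ++ a))
      (2 * l.length + 4 * m.length + 7) := by
  have h₁ : RunW (clear .d) (tp a [] [] (bits l) (bits m) [] []) (tp a [] [] [] (bits m) [] []) _ :=
    runW_clear (by simp)
  have h₂ : RunW (.blk (push .a (fun _ => .cut) done)) (tp a [] [] [] (bits m) [] [])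
    (tp (.cut :: a) [] [] [] (bits m) [] []) _ := .blk fun r => ⟨r, by simp⟩
  have h₃ : RunW (moveAll .e .b) (tp (.cut :: a) [] [] [] (bits m) [] [])
    (tp (.cut :: a) (bits m).reverse [] [] [] [] []) _ := runW_moveAll (by decide) (by simp)
  have h₄ : RunW (moveAll .b .a) (tp (.cut :: a) (bits m).reverse [] [] [] [] [])
    (st ((num m).enc ++ a)) _ := runW_moveAll (by decide) (by simp [st, enc_num])
  exact (h₁.seq (h₂.seq (h₃.seq h₄))).mono (by simp; omega)

theorem Realizes.add (l m : List Bool) :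
    Realizes (.seq loadNums (.seq addNums storeNum)) (.pair (num l) (num m))
      (num (addBits l m false)) (16 * l.length + 12 * m.length + 31) := by
  intro a
  have := length_addBits l m false
  exact ((runW_loadNums l m a).seq ((runW_addNums l m a []).seq (runW_storeNum _ _ a))).mono
    (by omega)

/-- Multiplication of binary numbers: the digits of the first one are given in reverse order, and
`acc` accumulates the product. -/
def mulBits : List Bool → List Bool → List Bool → List Bool
  | [], _, acc => acc
  | true :: l, m, acc => mulBits l m (addBits m (false :: acc) false)
  | false :: l, m, acc => mulBits l m (false :: acc)

theorem binVal_append (l m : List Bool) :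
    binVal (l ++ m) = binVal l + 2 ^ l.length * binVal m := by
  simp [binVal, Nat.ofDigits_append]

/-- Horner's rule from the most significant digit: prepending a zero digit doubles the accumulator.
-/
theorem binVal_mulBits (l m acc : List Bool) :
    binVal (mulBits l m acc) = 2 ^ l.length * binVal acc + binVal l.reverse * binVal m := by
  induction l generalizing acc with
  | nil => simp [mulBits]
  | cons x l ih =>
    cases x <;>
      simp [mulBits, ih, binVal_addBits, binVal_append, binVal_cons] <;> ring

/-- Each digit adds at most two to the excess `k` over the length of `m`, one for the shift and one
for the carry. -/
theorem length_mulBits (l m acc : List Bool) (k : ℕ) (h : acc.length ≤ m.length + k) :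
    (mulBits l m acc).length ≤ m.length + k + 2 * l.length := by
  induction l generalizing acc k with
  | nil => simpa [mulBits] using h
  | cons x l ih =>
    cases x
    · have := ih (false :: acc) (k + 2) (by simp; omega)
      simp [mulBits]; omega
    · have h' := length_addBits m (false :: acc) false
      have := ih (addBits m (false :: acc) false) (k + 2) (by simp at h'; omega)
      simp [mulBits]; omega

/-- One step of multiplication: shift the number on `e`, and add the number on `d` if the symbol on
top of `b`, which is removed, is the digit one. -/
def mulStep : Program :=
  .seq (.blk (push .e (fun _ => .chr (.bit false)) done))
    (.seq (iteTop .b digit addNums skip) (.blk (pop .b (fun r _ => r) done)))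

/-- Multiply the numbers on `b` (reversed) and `d`. -/
def mulLoop : Program := iteTop .b Option.isSome (loopTop .b Option.isSome mulStep) skip

theorem runW_mulStep (x : Bool) (m acc : List Bool) (a b : List Sym) :
    RunW mulStep (tp a (.chr (.bit x) :: b) [] (bits m) (bits acc) [] [])
      (tp a b [] (bits m) (bits (mulBits [x] m acc)) [] []) (6 * m.length + 4 * acc.length + 19) := by
  have h₁ : RunW (.blk (push .e (fun _ => .chr (.bit false)) done))
    (tp a (.chr (.bit x) :: b) [] (bits m) (bits acc) [] [])
    (tp a (.chr (.bit x) :: b) [] (bits m) (bits (false :: acc)) [] []) _ :=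
    .blk fun r => ⟨r, by simp⟩
  have h₂ : RunW (iteTop .b digit addNums skip)
    (tp a (.chr (.bit x) :: b) [] (bits m) (bits (false :: acc)) [] [])
    (tp a (.chr (.bit x) :: b) [] (bits m) (bits (mulBits [x] m acc)) [] [])
    (6 * m.length + 4 * acc.length + 17) := by
    cases x
    · exact (RunW.iteTop_false rfl (runW_skip _)).mono (by omega)
    · exact (RunW.iteTop_true rfl (runW_addNums m (false :: acc) a _)).mono (by simp; omega)
  have h₃ : RunW (.blk (pop .b (fun r _ => r) done))
    (tp a (.chr (.bit x) :: b) [] (bits m) (bits (mulBits [x] m acc)) [] [])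
    (tp a b [] (bits m) (bits (mulBits [x] m acc)) [] []) _ := .blk fun r => ⟨r, by simp⟩
  exact (h₁.seq (h₂.seq h₃)).mono (by omega)

theorem mulBits_cons (x : Bool) (l m acc : List Bool) :
    mulBits (x :: l) m acc = mulBits l m (mulBits [x] m acc) := by cases x <;> rfl

/-- The number `n` bounds the excess length of the accumulator in all remaining rounds, so that
every round has the same cost estimate. -/
theorem runW_loopTop_mulStep (x : Bool) (l m acc : List Bool) (a : List Sym) (k n : ℕ)
    (h : acc.length ≤ m.length + k) (hn : k + 2 * l.length ≤ n) :
    RunW (loopTop .b Option.isSome mulStep) (tp a (bits (x :: l)) [] (bits m) (bits acc) [] [])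
      (tp a [] [] (bits m) (bits (mulBits (x :: l) m acc)) [] [])
      ((l.length + 1) * (10 * m.length + 4 * n + 21)) := by
  induction l generalizing x acc k with
  | nil =>
    exact (RunW.loopTop_done (runW_mulStep x m acc a (bits [])) rfl).mono (by simp; omega)
  | cons y l ih =>
    have h' := length_mulBits [x] m acc k h
    rw [mulBits_cons]
    refine (RunW.loopTop_more (runW_mulStep x m acc a (bits (y :: l))) rfl
      (ih y (mulBits [x] m acc) (k + 2) (by simpa [add_assoc] using h') (by simp at hn; omega))).mono ?_
    rw [List.length_cons, Nat.add_mul (l.length + 1)]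
    omega

theorem runW_mulLoop (l m : List Bool) (a : List Sym) :
    RunW mulLoop (tp a (bits l) [] (bits m) [] [] [])
      (tp a [] [] (bits m) (bits (mulBits l m [])) [] [])
      (l.length * (10 * m.length + 8 * l.length + 21) + 3) := by
  cases l with
  | nil => exact (RunW.iteTop_false rfl (runW_skip _)).mono (by simp)
  | cons x l =>
    exact (RunW.iteTop_true rfl (runW_loopTop_mulStep x l m [] a 0 (2 * l.length) (by simp)
      (by simp))).mono (by
        rw [List.length_cons]; exact add_le_add (Nat.mul_le_mul le_rfl (by omega)) (by omega))

theorem Realizes.mul (l m : List Bool) :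
    Realizes (.seq loadNums (.seq (moveAll .d .b) (.seq (moveAll .e .c) (.seq (moveAll .c .d)
      (.seq mulLoop storeNum))))) (.pair (num l) (num m)) (num (mulBits l.reverse m []))
      (l.length * (10 * m.length + 8 * l.length + 21) + 14 * l.length + 14 * m.length + 25) := by
  intro a
  have h₁ : RunW (moveAll .d .b) (tp a [] [] (bits l) (bits m) [] [])
    (tp a (bits l.reverse) [] [] (bits m) [] []) _ := runW_moveAll (by decide) (by simp [bits])
  have h₂ : RunW (moveAll .e .c) (tp a (bits l.reverse) [] [] (bits m) [] [])
    (tp a (bits l.reverse) (bits m).reverse [] [] [] []) _ := runW_moveAll (by decide) (by simp)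
  have h₃ : RunW (moveAll .c .d) (tp a (bits l.reverse) (bits m).reverse [] [] [] [])
    (tp a (bits l.reverse) [] (bits m) [] [] []) _ := runW_moveAll (by decide) (by simp)
  have h₄ := length_mulBits l.reverse m [] 0 (by simp)
  refine ((runW_loadNums l m a).seq (h₁.seq (h₂.seq (h₃.seq ((runW_mulLoop l.reverse m a).seq
    (runW_storeNum m _ a)))))).mono ?_
  simp at h₄ ⊢
  omega

/-- One step of a comparison, starting with the least significant digits. -/
def ltStep (x y c : Bool) : Bool := if x ^^ y then y else c

/-- Comparison of binary numbers; `x` is the result if they are equal. -/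
def ltBits : List Bool → List Bool → Bool → Bool
  | [], [], x => x
  | x :: l, [], c => ltBits l [] (ltStep x false c)
  | [], y :: m, c => ltBits [] m (ltStep false y c)
  | x :: l, y :: m, c => ltBits l m (ltStep x y c)

/-- Starting from the low end, the last pair of different digits decides; the Boolean argument is
the verdict on the digits already read. -/
theorem ltBits_eq (l m : List Bool) (x : Bool) :
    ltBits l m x = decide (binVal l < binVal m ∨ binVal l = binVal m ∧ x = true) := by
  induction l, m, x using ltBits.induct with
  | case1 => simp [ltBits]
  | case2 x l c ih =>
    rw [ltBits, ih, binVal_cons, decide_eq_decide]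
    cases x <;> cases c <;> simp [ltStep]
  | case3 y m c ih =>
    rw [ltBits, ih, binVal_cons, decide_eq_decide]
    cases y <;> cases c <;> simp [ltStep] <;> omega
  | case4 x l y m c ih =>
    rw [ltBits, ih, binVal_cons, binVal_cons, decide_eq_decide]
    cases x <;> cases y <;> cases c <;> simp [ltStep] <;> omega

/-- Compare the numbers on the stacks `d` and `e`. -/
def ltLoop : Program :=
  .loop (.blk (pop .d (fun r s => (s, r.2)) (pop .e (fun r s => (r.1, s, r.2.2))
    (load (fun r => (if r.1.isSome || r.2.1.isSome then some .cut else none, none,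
      ltStep (digit r.1) (digit r.2.1) r.2.2)) done)))) fun r => r.1.isSome

theorem run_ltLoop (l m : List Bool) (x : Bool) (r₁ r₂ : Option Sym) (a : List Sym) :
    ∃ t, t ≤ 2 * l.length + 2 * m.length + 2 ∧
      Run ltLoop ((r₁, r₂, x), full (tp a [] [] (bits l) (bits m) [] [])) t
        ((none, none, ltBits l m x), full (st a)) := by
  induction l, m, x using ltBits.induct generalizing r₁ r₂ with
  | case1 =>
    -- The last pass finds both stacks empty and reads two zero digits, which leaves the verdict
    -- unchanged.
    refine ⟨2, by simp, .loop_blk_done ?_ rfl⟩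
    simp [ltBits, digit, st, ltStep]
  | case2 x l c ih =>
    obtain ⟨t, ht, hr⟩ := ih (some .cut) none
    refine ⟨t + 2, by simp at ht ⊢; omega, .loop_blk_more (S' := (_, _)) ?_ rfl
      (by simpa [ltBits, ltLoop] using hr)⟩
    simp [digit]
  | case3 y m c ih =>
    obtain ⟨t, ht, hr⟩ := ih (some .cut) none
    refine ⟨t + 2, by simp at ht ⊢; omega, .loop_blk_more (S' := (_, _)) ?_ rfl
      (by simpa [ltBits, ltLoop] using hr)⟩
    simp [digit]
  | case4 x l y m c ih =>
    obtain ⟨t, ht, hr⟩ := ih (some .cut) none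
    refine ⟨t + 2, by simp at ht ⊢; omega, .loop_blk_more (S' := (_, _)) ?_ rfl
      (by simpa [ltBits, ltLoop] using hr)⟩
    simp [digit]

/-- A truth value, as a tree. -/
def flag (x : Bool) : V := .atom (if x then [.bit true] else [])

/-- Compare two numbers. -/
def ltProg : Program :=
  .seq loadNums (.seq (.seq (.blk (load (fun _ => (none, none, false)) done)) ltLoop)
    (.blk (push .a (fun _ => .cut) (branch (fun r => r.2.2)
      (push .a (fun _ => .chr (.bit true)) done) done))))

theorem Realizes.lt (l m : List Bool) :
    Realizes ltProg (.pair (num l) (num m)) (flag (decide (binVal l < binVal m)))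
      (6 * l.length + 6 * m.length + 13) := by
  intro a r
  obtain ⟨r', t, ht, hr⟩ := runW_loadNums l m a r
  obtain ⟨t', ht', hr'⟩ := run_ltLoop l m false none none a
  refine ⟨(none, none, ltBits l m false), t + (1 + t' + 1), by omega, .seq hr (.seq (.seq (.blk _ _) hr') ?_)⟩
  have e : exec (push .a (fun _ => .cut) (branch (fun r => r.2.2)
      (push .a (fun _ => .chr (.bit true)) done) done)) ((none, none, ltBits l m false), full (st a)) =
      ((none, none, ltBits l m false), full (st ((flag (decide (binVal l < binVal m))).enc ++ a))) := by
    have h : ltBits l m false = decide (binVal l < binVal m) := by simp [ltBits_eq]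
    rw [h]
    by_cases h' : binVal l < binVal m <;> simp [h', st, flag, enc]
  exact e ▸ Run.blk _ _

end StackProg

/-! ### Feasible functions and their closure under composition, case distinction and folds. -/

namespace StackProg

open Turing Turing.TM2 V

/-- Types whose elements are represented by trees. -/
class Rep (α : Type) where
  /-- `rep v x`: the tree `v` represents `x`. -/
  rep : V → α → Prop

open StackProg.Rep

/-- A tree of at most `B` nodes, of total length at most `B * (N + 1)`. -/
def Bounded (B N : ℕ) (v : V) : Prop := v.nodes ≤ B ∧ v.size ≤ B * (N + 1)

theorem Bounded.mono {B B' N : ℕ} {v : V} (h : Bounded B N v) (hB : B ≤ B') : Bounded B' N v :=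
  ⟨h.1.trans hB, h.2.trans (Nat.mul_le_mul_right _ hB)⟩

variable {α β γ δ : Type} [Rep α] [Rep β] [Rep γ] [Rep δ]

/-- Functions computed by programs whose running time is at most quadratic in the length of the
strings in the input, with a factor that depends on the shape of the input only. -/
def Feasible (f : α → β) : Prop :=
  ∃ (P : Program) (g : ℕ → ℕ), Primrec g ∧ Monotone g ∧ ∀ (B N : ℕ) (v : V) (x : α),
    rep v x → Bounded B N v →
    ∃ w : V, rep w (f x) ∧ Bounded (g B) N w ∧ Realizes P v w (g B * (N + 1) ^ 2)

theorem le_mul_sq {a b N : ℕ} (h : a ≤ b * (N + 1)) : a ≤ b * (N + 1) ^ 2 := by nlinarith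

theorem le_mul_sq_of_le {a K n : ℕ} (h : a ≤ K * n) : a ≤ K * n ^ 2 :=
  h.trans (Nat.mul_le_mul_left _ (Nat.le_self_pow two_ne_zero n))

theorem primrec_poly (K : ℕ) : Primrec fun B : ℕ => K * (B + 1) ^ 2 := by
  simp only [pow_two]
  exact Primrec.nat_mul.comp (Primrec.const _) (Primrec.nat_mul.comp Primrec.succ Primrec.succ)

theorem monotone_poly (K : ℕ) : Monotone fun B : ℕ => K * (B + 1) ^ 2 := fun a b h => by
  dsimp only; gcongr

theorem V.one_le_size (v : V) : 1 ≤ v.size := by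
  cases v <;> simp

/-- The way in for elementary programs. Quadratic time in the length of the tree is enough, since
this length is at most `B * (N + 1)`. The number of nodes may grow only by a constant, so that the
shape of the result stays independent of `N`. -/
theorem Feasible.of_realizes {f : α → β} (P : Program) (K : ℕ)
    (h : ∀ v x, rep v x → ∃ w, rep w (f x) ∧ w.nodes ≤ v.nodes + K ∧ w.size ≤ K * v.size ∧
      Realizes P v w (K * v.size ^ 2)) : Feasible f := by
  refine ⟨P, fun B => (K + 1) * (B + 1) ^ 2, primrec_poly _, monotone_poly _,
    fun B N v x hx hv => ?_⟩
  obtain ⟨w, hw, h₁, h₂, h₃⟩ := h v x hx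
  have h₀ := hv.1
  refine ⟨w, hw, ⟨?_, h₂.trans ?_⟩, h₃.mono ?_⟩
  · calc w.nodes ≤ B + K := by omega
      _ ≤ (K + 1) * (B + 1) := by nlinarith
      _ ≤ (K + 1) * (B + 1) ^ 2 := le_mul_sq_of_le le_rfl
  · calc K * v.size ≤ K * (B * (N + 1)) := by gcongr; exact hv.2
      _ = K * B * (N + 1) := by ring
      _ ≤ (K + 1) * (B + 1) ^ 2 * (N + 1) := by gcongr <;> nlinarith
  · calc K * v.size ^ 2 ≤ K * (B * (N + 1)) ^ 2 := by gcongr; exact hv.2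
      _ = K * B ^ 2 * (N + 1) ^ 2 := by ring
      _ ≤ (K + 1) * (B + 1) ^ 2 * (N + 1) ^ 2 := by gcongr <;> omega

theorem Feasible.of_eq {f g : α → β} (hf : Feasible f) (h : ∀ x, f x = g x) : Feasible g :=
  funext h ▸ hf

theorem Feasible.of_rep_imp {f : α → β} (h : ∀ v x, rep v x → rep v (f x)) : Feasible f :=
  .of_realizes skip 1 fun v x hx =>
    ⟨v, h v x hx, by simp, by simp, Realizes.skip.mono (by have := one_le_size v; nlinarith)⟩

theorem Feasible.id : Feasible fun x : α => x := .of_rep_imp fun _ _ h => h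

/-- Here the separation of `B` and `N` pays off: the intermediate result is bounded by `k B` and the
same `N`, so the two times add up and the exponent of `N + 1` stays two. -/
theorem Feasible.comp {f : β → γ} {h : α → β} (hf : Feasible f) (hh : Feasible h) :
    Feasible fun x => f (h x) := by
  obtain ⟨P, g, pg, mg, hP⟩ := hf
  obtain ⟨Q, k, pk, mk, hQ⟩ := hh
  refine ⟨.seq Q P, fun B => k B + g (k B), Primrec.nat_add.comp pk (pg.comp pk),
    fun a b hab => add_le_add (mk hab) (mg (mk hab)), fun B N v x hx hv => ?_⟩
  obtain ⟨w, hw, bw, rw⟩ := hQ B N v x hx hv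
  obtain ⟨y, hy, by', ry⟩ := hP (k B) N w _ hw bw
  exact ⟨y, hy, by'.mono (by simp), (rw.seq ry).mono (by rw [add_mul])⟩

instance : Rep Unit := ⟨fun v _ => v = .atom []⟩

instance : Rep Bool := ⟨fun v x => v = flag x⟩

/-- Leading zeros are allowed, so a number has many trees. All of them are atoms: arithmetic makes
them longer but does not alter the shape of the data. -/
instance : Rep ℕ := ⟨fun v n => ∃ l, v = num l ∧ binVal l = n⟩

/-- Strings, as single data items. -/
structure Str : Type where
  /-- The symbols of the string. -/
  str : List RatSym

/-- One atom whatever its length, so that the length of the input affects `N` only. In return,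
strings are not lists that could be folded over. -/
instance : Rep Str := ⟨fun v s => v = .atom s.str⟩

instance : Rep (α × β) := ⟨fun v x => ∃ v₁ v₂, v = .pair v₁ v₂ ∧ rep v₁ x.1 ∧ rep v₂ x.2⟩

/-- The representation of lists. -/
def repList : V → List α → Prop
  | v, [] => v = .atom []
  | v, x :: l => ∃ v₁ v₂, v = .pair v₁ v₂ ∧ rep v₁ x ∧ repList v₂ l

instance : Rep (List α) := ⟨repList⟩

instance : Rep (Option α) := ⟨fun v x => rep v x.toList⟩

theorem Feasible.fst : Feasible fun x : α × β => x.1 :=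
  .of_realizes (.seq unmark (.seq swap drop)) 40 fun v x hx => by
    obtain ⟨v₁, v₂, rfl, h₁, h₂⟩ := hx
    refine ⟨v₁, h₁, by simp [nodes]; omega, by simp; omega, Realizes.fst.mono (le_mul_sq_of_le ?_)⟩
    simp only [size_pair]
    omega

theorem Feasible.snd : Feasible fun x : α × β => x.2 :=
  .of_realizes (.seq unmark drop) 40 fun v x hx => by
    obtain ⟨v₁, v₂, rfl, h₁, h₂⟩ := hx
    refine ⟨v₂, h₂, by simp [nodes]; omega, by simp; omega, Realizes.snd.mono (le_mul_sq_of_le ?_)⟩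
    simp only [size_pair]
    omega

theorem Feasible.pair {f : α → β} {h : α → γ} (hf : Feasible f) (hh : Feasible h) :
    Feasible fun x => (f x, h x) := by
  obtain ⟨P, g, pg, mg, hP⟩ := hf
  obtain ⟨Q, k, pk, mk, hQ⟩ := hh
  refine ⟨pairProg P Q, fun B => 13 * (g B + k B) + 12 * B + 39, ?_, fun a b hab => ?_,
    fun B N v x hx hv => ?_⟩
  rotate_left
  · have := mg hab
    have := mk hab
    dsimp only
    omega
  · obtain ⟨w, hw, bw, rw⟩ := hP B N v x hx hv
    obtain ⟨y, hy, by', ry⟩ := hQ B N v x hx hv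
    have h₁ := bw.1
    have h₂ := by'.1
    have h₃ := bw.2
    have h₄ := by'.2
    have h₅ := hv.2
    refine ⟨.pair w y, ⟨w, y, rfl, hw, hy⟩, ⟨by simp only [nodes]; omega, ?_⟩, (rw.pair ry).mono ?_⟩
    · simp only [size_pair]
      nlinarith
    · have h₃ := le_mul_sq h₃
      have h₄ := le_mul_sq h₄
      have h₅ := le_mul_sq h₅
      have h₆ : 1 ≤ (N + 1) ^ 2 := Nat.one_le_pow _ _ (by omega)
      nlinarith
  · exact Primrec.nat_add.comp (Primrec.nat_add.comp
      (Primrec.nat_mul.comp (Primrec.const _) (Primrec.nat_add.comp pg pk))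
      (Primrec.nat_mul.comp (Primrec.const _) Primrec.id)) (Primrec.const _)

theorem Feasible.const_of_rep {y : β} {w : V} (hw : rep w y) : Feasible fun _ : α => y :=
  .of_realizes (.seq drop (.blk (pushes w.enc.reverse))) (w.nodes + w.size + 10) fun v x _ => by
    have := one_le_size v
    exact ⟨w, hw, by omega, by nlinarith, (Realizes.const v w).mono (by nlinarith)⟩

theorem Feasible.nil : Feasible fun _ : α => ([] : List β) := .const_of_rep (w := .atom []) rfl

theorem Feasible.bool (b : Bool) : Feasible fun _ : α => b := .const_of_rep (w := flag b) rfl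

theorem Feasible.unit : Feasible fun _ : α => () := .const_of_rep (w := .atom []) rfl

theorem Feasible.cons {f : α → β} {h : α → List β} (hf : Feasible f) (hh : Feasible h) :
    Feasible fun x => f x :: h x :=
  (Feasible.of_rep_imp (f := fun x : β × List β => x.1 :: x.2) fun _ _ h => h).comp (hf.pair hh)

/-- In the positive case the same tree may be read as an element of another type `δ`. This gives
access to head and tail at no cost: the tree of a nonempty list is already a pair. -/
theorem Feasible.branch {c : α → β} (hc : Feasible c) {p : α → Prop} [DecidablePred p]
    (hp : ∀ v x, rep v (c x) → (isStop v.enc.head? = false ↔ p x)) {f h : α → γ} {k : δ → γ}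
    (hk : Feasible k) (hf : ∀ v x, p x → rep v x → ∃ z : δ, rep v z ∧ k z = f x)
    (hh : Feasible h) : Feasible fun x => if p x then f x else h x := by
  obtain ⟨P, g₁, pg₁, mg₁, hP⟩ := hc
  obtain ⟨Q, g₂, pg₂, mg₂, hQ⟩ := hk
  obtain ⟨R, g₃, pg₃, mg₃, hR⟩ := hh
  refine ⟨iteProg P Q R, fun B => 5 * g₁ B + g₂ B + g₃ B + 8 * B + 16, ?_, fun a b hab => ?_,
    fun B N v x hx hv => ?_⟩
  rotate_left
  · have := mg₁ hab
    have := mg₂ hab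
    have := mg₃ hab
    dsimp only
    omega
  · obtain ⟨w, hw, bw, rw⟩ := hP B N v x hx hv
    have hw' := hp w x hw
    have h₃ := le_mul_sq bw.2
    have h₅ := le_mul_sq hv.2
    have h₆ : 1 ≤ (N + 1) ^ 2 := Nat.one_le_pow _ _ (by omega)
    by_cases h : p x
    · obtain ⟨z, hz, e⟩ := hf v x h hx
      obtain ⟨y, hy, by', ry⟩ := hQ B N v z hz hv
      refine ⟨y, by simpa [h, e] using hy, by'.mono (by dsimp only; omega),
        (rw.iteTrue (hw'.2 h) ry).mono (by nlinarith)⟩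
    · obtain ⟨y, hy, by', ry⟩ := hR B N v x hx hv
      refine ⟨y, by simpa [h] using hy, by'.mono (by dsimp only; omega), (rw.iteFalse ?_ ry).mono (by nlinarith)⟩
      rw [← hw'] at h
      simpa using h
  · exact Primrec.nat_add.comp (Primrec.nat_add.comp (Primrec.nat_add.comp (Primrec.nat_add.comp
      (Primrec.nat_mul.comp (Primrec.const _) pg₁) pg₂) pg₃)
      (Primrec.nat_mul.comp (Primrec.const _) Primrec.id)) (Primrec.const _)

theorem Feasible.ite {c : α → Bool} (hc : Feasible c) {f h : α → γ} (hf : Feasible f)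
    (hh : Feasible h) : Feasible fun x => if c x then f x else h x :=
  hc.branch (p := fun x => c x = true) (fun v x hv => by
    cases hv; cases c x <;> simp [flag, enc, isStop]) hf (fun _ x _ hv => ⟨x, hv, rfl⟩) hh

theorem Feasible.listCase {f : α × (β × List β) → γ} (hf : Feasible f) {h : α → γ}
    (hh : Feasible h) {l : α → List β} (hl : Feasible l) :
    Feasible fun x => match l x with
      | [] => h x
      | y :: t => f (x, (y, t)) := by
  have H : Feasible fun x : α × List β => if x.2 ≠ [] then
      (match x.2 with
      | [] => h x.1
      | y :: t => f (x.1, (y, t))) else h x.1 := by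
    refine Feasible.snd.branch ?_ hf ?_ (hh.comp .fst)
    · rintro v ⟨x, l⟩ hv
      cases l with
      | nil => cases hv; simp [enc, isStop]
      | cons y t => obtain ⟨v₁, v₂, rfl, -⟩ := hv; simp [enc, isStop]
    · rintro v ⟨x, l⟩ hl ⟨v₁, v₂, rfl, h₁, h₂⟩
      cases l with
      | nil => simp at hl
      | cons y t => exact ⟨(x, (y, t)), ⟨v₁, v₂, rfl, h₁, h₂⟩, rfl⟩
  refine (H.comp (Feasible.id.pair hl)).of_eq fun x => ?_
  dsimp only
  cases l x <;> simp

theorem Feasible.none : Feasible fun _ : α => (Option.none : Option β) :=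
  .const_of_rep (w := .atom []) rfl

theorem Feasible.some {f : α → β} (hf : Feasible f) : Feasible fun x => Option.some (f x) :=
  (Feasible.of_rep_imp (f := fun x : β × Unit => Option.some x.1) fun _ _ h => h).comp
    (hf.pair .unit)

theorem Feasible.optionElim {f : α × β → γ} (hf : Feasible f) {h : α → γ} (hh : Feasible h)
    {o : α → Option β} (ho : Feasible o) : Feasible fun x => (o x).elim (h x) fun y => f (x, y) := by
  have H : Feasible fun x => (o x).toList :=
    (Feasible.of_rep_imp (f := fun x : Option β => x.toList) fun _ _ h => h).comp ho
  refine (Feasible.listCase (hf.comp (Feasible.fst.pair (Feasible.fst.comp .snd))) hh H).of_eq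
    fun x => ?_
  cases o x <;> rfl

theorem Feasible.optionBind {f : α × β → Option γ} (hf : Feasible f)
    {o : α → Option β} (ho : Feasible o) : Feasible fun x => (o x).bind fun y => f (x, y) :=
  (hf.optionElim .none ho).of_eq fun x => by cases o x <;> rfl

theorem rep_list_iff (v : V) (l : List α) :
    rep v l ↔ ∃ vs : List V, v = V.list vs ∧ List.Forall₂ rep vs l := by
  induction l generalizing v with
  | nil => 
    constructor
    · rintro rfl
      exact ⟨[], rfl, .nil⟩
    · rintro ⟨_, rfl, ⟨⟩⟩
      rfl
  | cons x l ih =>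
    constructor
    · rintro ⟨v₁, v₂, rfl, h₁, h₂⟩
      obtain ⟨vs, rfl, h⟩ := (ih v₂).1 h₂
      exact ⟨v₁ :: vs, rfl, .cons h₁ h⟩
    · rintro ⟨_, rfl, h⟩
      obtain ⟨h₁, h₂⟩ := h
      exact ⟨_, _, rfl, ‹_›, (ih _).2 ⟨_, rfl, ‹_›⟩⟩

theorem nodes_list (vs : List V) : vs.length ≤ (V.list vs).nodes := by
  induction vs with
  | nil => simp
  | cons v vs ih => simp [V.list, nodes]; omega

/-- If the accumulator and the rest of the list are bounded by `X`, their next pair is bounded by `2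
* X + 1` and the new accumulator by `g (2 * X + 1)`. The coefficients in `9 * g (2 * X + 1) + 25 * X
+ 41` also cover the cost of the round in `Folds.cons`, so one quantity controls size and time. The
summand `X * (N + 1) ^ 2` next to `T` makes the time estimate telescope. -/
theorem exists_folds {P : Program} {g : ℕ → ℕ} {f : β × γ → β}
    (hP : ∀ (B N : ℕ) (v : V) (x : β × γ), rep v x → Bounded B N v →
      ∃ w : V, rep w (f x) ∧ Bounded (g B) N w ∧ Realizes P v w (g B * (N + 1) ^ 2))
    (N : ℕ) {vs : List V} {l : List γ} (hl : List.Forall₂ rep vs l) (X : ℕ)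
    (hX : Bounded X N (V.list vs)) (v : V) (y : β) (hv : rep v y) (bv : Bounded X N v) :
    ∃ w T, rep w (l.foldl (fun b c => f (b, c)) y) ∧ Folds P v vs w T ∧
      Bounded ((fun X => 9 * g (2 * X + 1) + 25 * X + 41)^[l.length] X) N w ∧
      X * (N + 1) ^ 2 + T ≤ (fun X => 9 * g (2 * X + 1) + 25 * X + 41)^[l.length] X * (N + 1) ^ 2 := by
  induction hl generalizing v y X with
  | nil => exact ⟨v, 0, hv, .nil v, bv, le_rfl⟩
  | @cons u c us l hc hl ih =>
    have e : (V.list (u :: us)).size = u.size + (V.list us).size + 1 := size_pair _ _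
    have e' : (V.list (u :: us)).nodes = u.nodes + (V.list us).nodes + 1 := rfl
    have hX₁ := hX.1
    have hX₂ := hX.2
    have bv₁ := bv.1
    have bv₂ := bv.2
    obtain ⟨v', hv', bv', rv'⟩ := hP (2 * X + 1) N (.pair v u) (y, c) ⟨v, u, rfl, hv, hc⟩
      ⟨by simp only [nodes]; omega, by rw [size_pair]; nlinarith⟩
    have hXX : X ≤ 9 * g (2 * X + 1) + 25 * X + 41 := by omega
    obtain ⟨w, T, hw, hf, bw, hT⟩ := ih (9 * g (2 * X + 1) + 25 * X + 41)
      ⟨by omega, by nlinarith⟩ v' _ hv' (bv'.mono (by omega))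
    refine ⟨w, _, hw, .cons rv' hf, bw, ?_⟩
    rw [List.length_cons, Function.iterate_succ_apply]
    refine le_trans ?_ hT
    have h₁ := le_mul_sq hX₂
    have h₂ := le_mul_sq bv₂
    have h₃ := le_mul_sq bv'.2
    have h₆ : 1 ≤ (N + 1) ^ 2 := Nat.one_le_pow _ _ (by omega)
    rw [e] at h₁
    nlinarith

/-- A list has at most as many items as its tree has nodes, so there are at most `B` rounds and
`h^[B] B` bounds everything. This is huge, but primitive recursive in `B` and independent of `N`. -/
theorem Feasible.foldl_aux {f : β × γ → β} (hf : Feasible f) :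
    Feasible fun x : β × List γ => x.2.foldl (fun b c => f (b, c)) x.1 := by
  obtain ⟨P, g, pg, mg, hP⟩ := hf
  set h : ℕ → ℕ := fun X => 9 * g (2 * X + 1) + 25 * X + 41 with hh
  have mh : Monotone h := fun a b hab => by
    have := mg (show 2 * a + 1 ≤ 2 * b + 1 by omega)
    simp only [hh]
    omega
  have ph : Primrec h :=
    Primrec.nat_add.comp (Primrec.nat_add.comp (Primrec.nat_mul.comp (Primrec.const _) (pg.comp
      (Primrec.nat_add.comp (Primrec.nat_mul.comp (Primrec.const _) Primrec.id) (Primrec.const _))))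
      (Primrec.nat_mul.comp (Primrec.const _) Primrec.id)) (Primrec.const _)
  have hle : _root_.id ≤ h := fun a => by simp only [hh, _root_.id]; omega
  refine ⟨fold P, fun B => h^[B] B + 12 * B + 30, ?_, fun a b hab => ?_, fun B N v x hx hv => ?_⟩
  · exact Primrec.nat_add.comp (Primrec.nat_add.comp (Primrec.nat_iterate Primrec.id Primrec.id
      (ph.comp Primrec.snd)) (Primrec.nat_mul.comp (Primrec.const _) Primrec.id)) (Primrec.const _)
  · have h₁ : h^[a] a ≤ h^[b] a := Function.monotone_iterate_of_id_le hle hab a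
    have h₂ : h^[b] a ≤ h^[b] b := mh.iterate b hab
    dsimp only
    omega
  · obtain ⟨v₁, v₂, rfl, h₁, h₂⟩ := hx
    obtain ⟨vs, rfl, hvs⟩ := (rep_list_iff v₂ x.2).1 h₂
    have hn := hv.1
    have hs := hv.2
    rw [size_pair] at hs
    simp only [nodes] at hn
    obtain ⟨w, T, hw, hf, bw, hT⟩ := exists_folds hP N hvs B ⟨by omega, by omega⟩ v₁ x.1 h₁
      ⟨by omega, by omega⟩
    have hlen : x.2.length ≤ B := by
      have := nodes_list vs
      have := hvs.length_eq
      omega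
    have hB : h^[x.2.length] B ≤ h^[B] B := Function.monotone_iterate_of_id_le hle hlen B
    refine ⟨w, hw, bw.mono (by rw [← hh]; dsimp only; omega), (Realizes.fold hf).mono ?_⟩
    rw [← hh] at hT
    have h₁ := le_mul_sq hs
    have h₆ : 1 ≤ (N + 1) ^ 2 := Nat.one_le_pow _ _ (by omega)
    have h₇ := Nat.mul_le_mul_right ((N + 1) ^ 2) hB
    nlinarith

/-- Folds whose operation depends on a further argument. -/
theorem Feasible.foldl {f : α × (β × γ) → β} (hf : Feasible f) {b : α → β} (hb : Feasible b)
    {l : α → List γ} (hl : Feasible l) :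
    Feasible fun x => (l x).foldl (fun y c => f (x, (y, c))) (b x) := by
  -- The further argument travels unchanged inside the accumulator.
  have H : Feasible fun z : (α × β) × γ => (z.1.1, f (z.1.1, (z.1.2, z.2))) :=
    (Feasible.fst.comp .fst).pair (hf.comp ((Feasible.fst.comp .fst).pair
      ((Feasible.snd.comp .fst).pair .snd)))
  refine (Feasible.snd.comp (H.foldl_aux.comp ((Feasible.id.pair hb).pair hl))).of_eq fun x => ?_
  dsimp only
  suffices h : ∀ (l : List γ) (y : β), (l.foldl (fun (z : α × β) c => (z.1, f (z.1, (z.2, c)))) (x, y)) =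
      (x, l.foldl (fun y c => f (x, (y, c))) y) by rw [h]
  intro l
  induction l with
  | nil => intro y; rfl
  | cons c l ih => intro y; exact ih _

end StackProg

/-! ### Feasible operations on lists, truth values, numbers and strings. -/

namespace StackProg

open V StackProg.Rep

variable {α β γ δ : Type} [Rep α] [Rep β] [Rep γ] [Rep δ]

namespace Feasible

/-- A function is feasible if it is represented by a feasible function between other types. -/
theorem of_lift {f : α → β} {F : γ → δ} (hF : Feasible F)
    (h : ∀ v x, rep v x → ∃ z, rep v z ∧ ∀ w, rep w (F z) → rep w (f x)) : Feasible f := by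
  obtain ⟨P, g, pg, mg, hP⟩ := hF
  refine ⟨P, g, pg, mg, fun B N v x hx hv => ?_⟩
  obtain ⟨z, hz, hzw⟩ := h v x hx
  obtain ⟨w, hw, H⟩ := hP B N v z hz hv
  exact ⟨w, hzw w hw, H⟩

theorem comp₂ {f : β × γ → δ} (hf : Feasible f) {g : α → β} {h : α → γ} (hg : Feasible g)
    (hh : Feasible h) : Feasible fun x => f (g x, h x) :=
  hf.comp (hg.pair hh)

section Lists

theorem reverse {l : α → List β} (hl : Feasible l) : Feasible fun x => (l x).reverse :=
  (foldl (f := fun z : α × (List β × β) => z.2.2 :: z.2.1)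
    ((snd.comp snd).cons (fst.comp snd)) nil hl).of_eq fun x => by
      simp

theorem append {l m : α → List β} (hl : Feasible l) (hm : Feasible m) :
    Feasible fun x => l x ++ m x :=
  (foldl (f := fun z : α × (List β × β) => z.2.2 :: z.2.1)
    ((snd.comp snd).cons (fst.comp snd)) hm hl.reverse).of_eq fun x => by
      simp

theorem map {f : α × β → γ} (hf : Feasible f) {l : α → List β} (hl : Feasible l) :
    Feasible fun x => (l x).map fun y => f (x, y) :=
  (foldl (f := fun z : α × (List γ × β) => f (z.1, z.2.2) :: z.2.1)
    ((hf.comp₂ fst (snd.comp snd)).cons (fst.comp snd)) nil hl).reverse.of_eq fun x => by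
      dsimp only
      suffices h : ∀ (l : List β) (m : List γ),
          l.foldl (fun m y => f (x, y) :: m) m = (l.map fun y => f (x, y)).reverse ++ m by simp [h]
      intro l
      induction l with
      | nil => simp
      | cons y l ih => simp [ih]

theorem flatMap {f : α × β → List γ} (hf : Feasible f) {l : α → List β} (hl : Feasible l) :
    Feasible fun x => (l x).flatMap fun y => f (x, y) :=
  (foldl (f := fun z : α × (List γ × β) => z.2.1 ++ f (z.1, z.2.2))
    ((fst.comp snd).append (hf.comp₂ fst (snd.comp snd))) nil hl).of_eq fun x => by
      dsimp only
      suffices h : ∀ (l : List β) (m : List γ),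
          l.foldl (fun m y => m ++ f (x, y)) m = m ++ (l.flatMap fun y => f (x, y)) by simp [h]
      intro l
      induction l with
      | nil => simp
      | cons y l ih => simp [ih]

theorem zipWith {f : α × (β × γ) → δ} (hf : Feasible f) {l : α → List β} (hl : Feasible l)
    {m : α → List γ} (hm : Feasible m) :
    Feasible fun x => (l x).zipWith (fun y z => f (x, (y, z))) (m x) := by
  -- The fold runs over the first list; its state holds the rest of the second list and the reversed
  -- output, and is frozen once the second list is used up.
  have H : Feasible fun z : α × ((List γ × List δ) × β) => match z.2.1.1 with
      | [] => z.2.1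
      | c :: t => (t, f (z.1, (z.2.2, c)) :: z.2.1.2) :=
    listCase (f := fun w : (α × ((List γ × List δ) × β)) × (γ × List γ) =>
      (w.2.2, f (w.1.1, (w.1.2.2, w.2.1)) :: w.1.2.1.2))
      ((snd.comp snd).pair ((hf.comp₂ (fst.comp fst) ((snd.comp (snd.comp fst)).pair
        (fst.comp snd))).cons (snd.comp (fst.comp (snd.comp fst)))))
      (fst.comp snd) (fst.comp (fst.comp snd))
  refine (snd.comp (H.foldl (hm.pair nil) hl)).reverse.of_eq fun x => ?_
  dsimp only
  suffices h : ∀ (l : List β) (m : List γ) (r : List δ),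
      (l.foldl (fun (z : List γ × List δ) y => match z.1 with
        | [] => z
        | c :: t => (t, f (x, (y, c)) :: z.2)) (m, r)).2 =
      (l.zipWith (fun y z => f (x, (y, z))) m).reverse ++ r by simp [h]
  intro l
  induction l with
  | nil => simp
  | cons y l ih =>
    intro m r
    cases m with
    | nil => simpa using ih [] r
    | cons c t => simp [ih]

theorem any {f : α × β → Bool} (hf : Feasible f) {l : α → List β} (hl : Feasible l) :
    Feasible fun x => (l x).any fun y => f (x, y) :=
  (foldl (f := fun z : α × (Bool × β) => if z.2.1 then true else f (z.1, z.2.2))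
    ((fst.comp snd).ite (.bool true) (hf.comp₂ fst (snd.comp snd))) (.bool false) hl).of_eq
    fun x => by
      dsimp only
      suffices h : ∀ (l : List β) (b : Bool),
          l.foldl (fun b y => if b = true then true else f (x, y)) b =
            (b || l.any fun y => f (x, y)) by rw [h, Bool.false_or]
      intro l
      induction l with
      | nil => simp
      | cons y l ih =>
        intro b
        rw [List.foldl_cons, ih]
        cases b <;> simp

end Lists

section Bools

variable {f h : α → Bool}

theorem not (hf : Feasible f) : Feasible fun x => !f x :=
  (hf.ite (.bool false) (.bool true)).of_eq fun x => by cases f x <;> rfl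

theorem and (hf : Feasible f) (hh : Feasible h) : Feasible fun x => f x && h x :=
  (hf.ite hh (.bool false)).of_eq fun x => by cases f x <;> rfl

end Bools

section Nats

theorem natConst (n : ℕ) : Feasible fun _ : α => n :=
  .const_of_rep (w := num (Nat.bits n)) ⟨_, rfl, by
    induction n using Nat.binaryRec' with
    | zero => rfl
    | bit b n h ih => rw [Nat.bits_append_bit _ _ h, binVal_cons, ih, Nat.bit_val]; ring⟩

theorem natAdd {f h : α → ℕ} (hf : Feasible f) (hh : Feasible h) : Feasible fun x => f x + h x :=
  comp (f := fun z : ℕ × ℕ => z.1 + z.2)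
    (.of_realizes (.seq loadNums (.seq addNums storeNum)) 40 fun v x hx => by
      obtain ⟨_, _, rfl, ⟨l, rfl, hl⟩, ⟨m, rfl, hm⟩⟩ := hx
      have h' := length_addBits l m false
      refine ⟨_, ⟨_, rfl, ?_⟩, ?_, ?_, (Realizes.add l m).mono (le_mul_sq_of_le ?_)⟩
      · simp [binVal_addBits, hl, hm]
      · simp [num, nodes]
      · simp; omega
      · simp; omega) (hf.pair hh)

theorem natMul {f h : α → ℕ} (hf : Feasible f) (hh : Feasible h) : Feasible fun x => f x * h x :=
  comp (f := fun z : ℕ × ℕ => z.1 * z.2)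
    (.of_realizes (.seq loadNums (.seq (moveAll .d .b) (.seq (moveAll .e .c) (.seq (moveAll .c .d)
      (.seq mulLoop storeNum))))) 100 fun v x hx => by
      obtain ⟨_, _, rfl, ⟨l, rfl, hl⟩, ⟨m, rfl, hm⟩⟩ := hx
      have h' := length_mulBits l.reverse m [] 0 (by simp)
      refine ⟨_, ⟨_, rfl, ?_⟩, ?_, ?_, (Realizes.mul l m).mono ?_⟩
      · simp [binVal_mulBits, hl, hm]
      · simp [num, nodes]
      · simp at h' ⊢; omega
      · simp only [size_pair, size_num]
        nlinarith) (hf.pair hh)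

theorem natLt {f h : α → ℕ} (hf : Feasible f) (hh : Feasible h) :
    Feasible fun x => decide (f x < h x) :=
  comp (f := fun z : ℕ × ℕ => decide (z.1 < z.2))
    (.of_realizes ltProg 40 fun v x hx => by
      obtain ⟨_, _, rfl, ⟨l, rfl, hl⟩, ⟨m, rfl, hm⟩⟩ := hx
      refine ⟨_, ?_, ?_, ?_, (Realizes.lt l m).mono (le_mul_sq_of_le ?_)⟩
      · change _ = _
        rw [← hl, ← hm]
      · simp [flag, nodes]
      · have : (flag (decide (binVal l < binVal m))).size ≤ 2 := by
          cases decide (binVal l < binVal m) <;> simp [flag]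
        simp; omega
      · simp; omega) (hf.pair hh)

end Nats

end Feasible

section Rationals

/-- The rational number `(n - m) / q`. -/
def fracVal (z : (ℕ × ℕ) × ℕ) : ℚ := ((z.1.1 : ℚ) - z.1.2) / z.2

/-- With differences of naturals as numerators, negation is an exchange, and sums, products and
comparisons need no case distinction on signs. Fractions are never reduced: feasibility absorbs
their growth. -/
instance : Rep ℚ := ⟨fun v r => ∃ z : (ℕ × ℕ) × ℕ, rep v z ∧ z.2 ≠ 0 ∧ fracVal z = r⟩

namespace Feasible

variable {f h : α → ℚ}

theorem ratNeg (hf : Feasible f) : Feasible fun x => -f x := by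
  have H : Feasible fun z : (ℕ × ℕ) × ℕ => ((z.1.2, z.1.1), z.2) :=
    ((snd.comp fst).pair (fst.comp fst)).pair snd
  refine comp (f := fun r : ℚ => -r) (H.of_lift ?_) hf
  rintro v r ⟨z, hz, h0, rfl⟩
  exact ⟨z, hz, fun w hw => ⟨_, hw, h0, by simp [fracVal]; ring⟩⟩

theorem ratAbs (hf : Feasible f) : Feasible fun x => |f x| := by
  have H : Feasible fun z : (ℕ × ℕ) × ℕ =>
      if decide (z.1.1 < z.1.2) then ((z.1.2, z.1.1), z.2) else z :=
    (natLt (fst.comp fst) (snd.comp fst)).ite (((snd.comp fst).pair (fst.comp fst)).pair snd) .id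
  refine comp (f := fun r : ℚ => |r|) (H.of_lift ?_) hf
  rintro v r ⟨z, hz, h0, rfl⟩
  refine ⟨z, hz, fun w hw => ⟨_, hw, ?_, ?_⟩⟩
  · split <;> exact h0
  · have hq : (0 : ℚ) < z.2 := by exact_mod_cast Nat.pos_of_ne_zero h0
    by_cases hlt : z.1.1 < z.1.2
    · have : ((z.1.1 : ℚ) - z.1.2) / z.2 < 0 :=
        div_neg_of_neg_of_pos (by rw [sub_neg]; exact_mod_cast hlt) hq
      simp only [hlt, fracVal, decide_true, if_true]
      rw [abs_of_neg this]
      ring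
    · have : 0 ≤ ((z.1.1 : ℚ) - z.1.2) / z.2 :=
        div_nonneg (by rw [sub_nonneg]; exact_mod_cast not_lt.1 hlt) hq.le
      simp only [hlt, fracVal, decide_false]
      simp [abs_of_nonneg this]

theorem ratAdd (hf : Feasible f) (hh : Feasible h) : Feasible fun x => f x + h x := by
  have H : Feasible fun z : ((ℕ × ℕ) × ℕ) × ((ℕ × ℕ) × ℕ) =>
      ((z.1.1.1 * z.2.2 + z.2.1.1 * z.1.2, z.1.1.2 * z.2.2 + z.2.1.2 * z.1.2), z.1.2 * z.2.2) :=
    (((natMul (fst.comp (fst.comp fst)) (snd.comp snd)).natAdd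
        (natMul (fst.comp (fst.comp snd)) (snd.comp fst))).pair
      ((natMul (snd.comp (fst.comp fst)) (snd.comp snd)).natAdd
        (natMul (snd.comp (fst.comp snd)) (snd.comp fst)))).pair
      (natMul (snd.comp fst) (snd.comp snd))
  refine comp (f := fun r : ℚ × ℚ => r.1 + r.2) (H.of_lift ?_) (hf.pair hh)
  rintro v ⟨_, _⟩ ⟨v₁, v₂, rfl, ⟨z, hz, h0, rfl⟩, ⟨y, hy, h1, rfl⟩⟩
  refine ⟨(z, y), ⟨v₁, v₂, rfl, hz, hy⟩, fun w hw => ⟨_, hw, mul_ne_zero h0 h1, ?_⟩⟩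
  have h0' : (z.2 : ℚ) ≠ 0 := by exact_mod_cast h0
  have h1' : (y.2 : ℚ) ≠ 0 := by exact_mod_cast h1
  simp only [fracVal]
  push_cast
  field_simp
  ring

theorem ratMul (hf : Feasible f) (hh : Feasible h) : Feasible fun x => f x * h x := by
  have H : Feasible fun z : ((ℕ × ℕ) × ℕ) × ((ℕ × ℕ) × ℕ) =>
      ((z.1.1.1 * z.2.1.1 + z.1.1.2 * z.2.1.2, z.1.1.1 * z.2.1.2 + z.1.1.2 * z.2.1.1),
        z.1.2 * z.2.2) :=
    (((natMul (fst.comp (fst.comp fst)) (fst.comp (fst.comp snd))).natAdd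
        (natMul (snd.comp (fst.comp fst)) (snd.comp (fst.comp snd)))).pair
      ((natMul (fst.comp (fst.comp fst)) (snd.comp (fst.comp snd))).natAdd
        (natMul (snd.comp (fst.comp fst)) (fst.comp (fst.comp snd))))).pair
      (natMul (snd.comp fst) (snd.comp snd))
  refine comp (f := fun r : ℚ × ℚ => r.1 * r.2) (H.of_lift ?_) (hf.pair hh)
  rintro v ⟨_, _⟩ ⟨v₁, v₂, rfl, ⟨z, hz, h0, rfl⟩, ⟨y, hy, h1, rfl⟩⟩
  refine ⟨(z, y), ⟨v₁, v₂, rfl, hz, hy⟩, fun w hw => ⟨_, hw, mul_ne_zero h0 h1, ?_⟩⟩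
  have h0' : (z.2 : ℚ) ≠ 0 := by exact_mod_cast h0
  have h1' : (y.2 : ℚ) ≠ 0 := by exact_mod_cast h1
  simp only [fracVal]
  push_cast
  field_simp
  ring

theorem ratLt (hf : Feasible f) (hh : Feasible h) : Feasible fun x => decide (f x < h x) := by
  have H : Feasible fun z : ((ℕ × ℕ) × ℕ) × ((ℕ × ℕ) × ℕ) =>
      decide (z.1.1.1 * z.2.2 + z.2.1.2 * z.1.2 < z.2.1.1 * z.1.2 + z.1.1.2 * z.2.2) :=
    ((natMul (fst.comp (fst.comp fst)) (snd.comp snd)).natAdd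
        (natMul (snd.comp (fst.comp snd)) (snd.comp fst))).natLt
      ((natMul (fst.comp (fst.comp snd)) (snd.comp fst)).natAdd
        (natMul (snd.comp (fst.comp fst)) (snd.comp snd)))
  refine comp (f := fun r : ℚ × ℚ => decide (r.1 < r.2)) (H.of_lift ?_) (hf.pair hh)
  rintro v ⟨_, _⟩ ⟨v₁, v₂, rfl, ⟨z, hz, h0, rfl⟩, ⟨y, hy, h1, rfl⟩⟩
  refine ⟨(z, y), ⟨v₁, v₂, rfl, hz, hy⟩, fun w hw => ?_⟩
  have h0' : (0 : ℚ) < z.2 := by exact_mod_cast Nat.pos_of_ne_zero h0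
  have h1' : (0 : ℚ) < y.2 := by exact_mod_cast Nat.pos_of_ne_zero h1
  have e : z.1.1 * y.2 + y.1.2 * z.2 < y.1.1 * z.2 + z.1.2 * y.2 ↔ fracVal z < fracVal y := by
    rw [fracVal, fracVal, div_lt_div_iff₀ h0' h1', ← @Nat.cast_lt ℚ]
    push_cast
    constructor <;> intro h <;> linarith
  simpa only [e] using hw

theorem ratConst (n : ℕ) : Feasible fun _ : α => (n : ℚ) := by
  have H : Feasible fun _ : α => ((n, 0), 1) := ((natConst n).pair (natConst 0)).pair (natConst 1)
  refine H.of_lift fun v x hx => ⟨x, hx, fun w hw => ⟨_, hw, one_ne_zero, by simp [fracVal]⟩⟩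

theorem ratDiv {a b : α → ℕ} (ha : Feasible a) (hb : Feasible b) :
    Feasible fun x => (a x : ℚ) / b x := by
  -- A zero denominator represents nothing; `0 / 1` agrees with the value of division by zero in
  -- `ℚ`.
  have H : Feasible fun z : ℕ × ℕ => if decide (0 < z.2) then ((z.1, 0), z.2) else ((0, 0), 1) :=
    (natLt (natConst 0) snd).ite ((fst.pair (natConst 0)).pair snd)
      (((natConst 0).pair (natConst 0)).pair (natConst 1))
  refine comp (f := fun z : ℕ × ℕ => (z.1 : ℚ) / z.2) (H.of_lift ?_) (ha.pair hb)
  rintro v ⟨n, m⟩ hv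
  refine ⟨_, hv, fun w hw => ⟨_, hw, ?_, ?_⟩⟩
  · rcases Nat.eq_zero_or_pos m with rfl | hm
    · simp
    · simp [hm, hm.ne']
  · rcases Nat.eq_zero_or_pos m with rfl | hm
    · simp [fracVal]
    · simp [hm, fracVal]

/-- The exponent is not part of the input: the induction builds a separate program for each `n`. -/
theorem ratPow (hf : Feasible f) (n : ℕ) : Feasible fun x => f x ^ n := by
  induction n with
  | zero => exact (ratConst 1).of_eq fun x => by simp
  | succ n ih => exact (ih.ratMul hf).of_eq fun x => (pow_succ _ _).symm

theorem ratSum {l : α → List ℚ} (hl : Feasible l) : Feasible fun x => (l x).sum :=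
  (foldl (f := fun z : α × (ℚ × ℚ) => z.2.1 + z.2.2)
    ((fst.comp snd).ratAdd (snd.comp snd)) (ratConst 0) hl).of_eq fun x => by
      simp [List.sum_eq_foldl]

end Feasible

end Rationals

section Strings

/-- Is the symbol a binary digit? -/
def isBit : RatSym → Bool
  | .bit _ => true
  | _ => false

/-- The value of a binary digit. -/
def bitVal : RatSym → Bool
  | .bit b => b
  | _ => false

/-- Does the string begin with a symbol in `q`? -/
def starts (q : RatSym → Bool) (s : Str) : Bool := !(s.str.takeWhile q).isEmpty

/-- Split off the longest prefix of binary digits, and return its value. -/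
def takeNat (s : Str) : ℕ × Str :=
  (binVal ((s.str.takeWhile isBit).map bitVal), ⟨s.str.dropWhile isBit⟩)

namespace Feasible

theorem span (q : RatSym → Bool) :
    Feasible fun s : Str => ((⟨s.str.takeWhile q⟩, ⟨s.str.dropWhile q⟩) : Str × Str) :=
  .of_realizes (.seq (takePrefix q) (.seq (.blk (push .a (fun _ => .cut) done))
    (.seq (moveAll .b .a) putMark))) 40 fun v s hs => by
      cases hs
      refine ⟨_, ⟨_, _, rfl, rfl, rfl⟩, by simp [nodes], ?_, (Realizes.span q s.str).mono ?_⟩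
      · have := (s.str.takeWhile_prefix q).length_le
        have := (s.str.dropWhile_suffix q).length_le
        simp; omega
      · refine le_mul_sq_of_le ?_
        simp; omega

theorem strTail {s : α → Str} (hs : Feasible s) : Feasible fun x => (⟨(s x).str.tail⟩ : Str) :=
  comp (f := fun s : Str => (⟨s.str.tail⟩ : Str)) (.of_realizes _ 40 fun v s hs => by
    cases hs
    exact ⟨_, rfl, by simp [nodes], by simp; omega, (Realizes.tail s.str).mono
      (le_mul_sq_of_le (by simp; omega))⟩) hs

theorem strNonempty {s : α → Str} (hs : Feasible s) : Feasible fun x => !(s x).str.isEmpty :=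
  (hs.branch (p := fun x => (!(s x).str.isEmpty) = true) (fun v x hv => by
    cases hv; cases h : (s x).str <;> simp [enc, isStop]) (bool true) (fun _ x _ hv => ⟨x, hv, rfl⟩)
    (bool false)).of_eq fun x => by cases (s x).str.isEmpty <;> rfl

theorem starts (q : RatSym → Bool) {s : α → Str} (hs : Feasible s) :
    Feasible fun x => starts q (s x) :=
  strNonempty (fst.comp ((span q).comp hs))

/-- No conversion takes place: a run of binary digits of the input is, as an atom, already the tree
of its value. -/
theorem takeNat {s : α → Str} (hs : Feasible s) : Feasible fun x => takeNat (s x) := by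
  refine comp (f := StackProg.takeNat) ((span isBit).of_lift ?_) hs
  rintro v s hv
  refine ⟨s, hv, ?_⟩
  rintro w ⟨w₁, w₂, rfl, rfl, h₂⟩
  refine ⟨_, w₂, rfl, ⟨_, ?_, rfl⟩, h₂⟩
  simp only [num, List.map_map]
  congr 1
  refine (List.map_id _).symm.trans (List.map_congr_left fun x hx => ?_)
  have := List.mem_takeWhile_imp hx
  cases x <;> simp_all [isBit, bitVal]

end Feasible

end Strings

end StackProg

/-! ### Input and output: from feasible functions to fixed-parameter tractability. -/

namespace StackProg

open Turing Turing.TM2 V StackProg.Rep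

/-- The contents of all stacks, given those of the input, output and work stacks. -/
def fullIO (i : List (Option RatSym)) (o : List Bool) (T : W → List Sym) : ∀ k, List (Alph k)
  | .inp => i
  | .out => o
  | .wk i => T i

theorem fullIO_nil (T : W → List Sym) : fullIO [] [] T = full T := by
  funext k; cases k <;> rfl

/-- Pop a symbol from the input. -/
def popInp (g : Reg → Option (Option RatSym) → Reg) (q : Blk) : Blk :=
  Stmt.pop (Γ := Alph) .inp g q

/-- Push a bit on the output. -/
def pushOut (b : Bool) (q : Blk) : Blk := Stmt.push (Γ := Alph) .out (fun _ => b) q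

section Exec

variable (r : Reg) (i : List (Option RatSym)) (o : List Bool) (T : W → List Sym)

theorem exec_popInp (g : Reg → Option (Option RatSym) → Reg) (q : Blk) :
    exec (popInp g q) (r, fullIO i o T) = exec q (g r i.head?, fullIO i.tail o T) := by
  have e : (Function.update (fullIO i o T) .inp i.tail : ∀ k, List (Alph k)) =
      fullIO i.tail o T := by
    funext k; cases k <;> rfl
  rw [← e]
  rfl

theorem exec_pushOut (b : Bool) (q : Blk) :
    exec (pushOut b q) (r, fullIO i o T) = exec q (r, fullIO i (b :: o) T) := by
  have e : (Function.update (fullIO i o T) .out (b :: o) : ∀ k, List (Alph k)) =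
      fullIO i (b :: o) T := by
    funext k; cases k <;> rfl
  rw [← e]
  rfl

theorem exec_push' (j : W) (g : Reg → Sym) (q : Blk) :
    exec (push j g q) (r, fullIO i o T) =
      exec q (r, fullIO i o (Function.update T j (g r :: T j))) := by
  have e : (Function.update (fullIO i o T) (.wk j) (g r :: T j) : ∀ k, List (Alph k)) =
      fullIO i o (Function.update T j (g r :: T j)) := by
    funext k
    rcases k with _ | _ | l
    · rfl
    · rfl
    · change _ = Function.update T j (g r :: T j) l
      by_cases h : l = j
      · subst h
        exact (Function.update_self _ _ _).trans (Function.update_self l _ T).symm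
      · rw [Function.update_of_ne h]
        exact Function.update_of_ne (by simpa using h) _ _
  rw [← e]
  rfl

end Exec

/-- The stack symbol for an input symbol. -/
def inSym : Option RatSym → Sym
  | none => .mark
  | some r => .chr r

/-- Read the input: the parameter goes to the stack `u`, the string to `b`. -/
def readLoop : Program :=
  .loop (.blk (popInp (fun r s => (s.map inSym, r.2))
    (branch (fun r => r.1.isSome) (branch (fun r => isMark r.1) (push .u (fun _ => .mark) done)
      (push .b (fun r => r.1.getD .cut) done)) done))) fun r => r.1.isSome

theorem run_readLoop (k : ℕ) (x : List RatSym) (b u : List Sym) (r : Reg) :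
    ∃ r', Run readLoop (r, fullIO (paramInput x k) [] (tp [] b [] [] [] [] u)) (2 * (k + x.length) + 2)
      (r', full (tp [] ((x.map .chr).reverse ++ b) [] [] [] [] (List.replicate k .mark ++ u))) := by
  induction k generalizing u r with
  | zero =>
    induction x generalizing b r with
    | nil =>
      refine ⟨(none, r.2), .loop_blk_done ?_ rfl⟩
      rw [show paramInput [] 0 = [] from rfl, exec_popInp]
      simp [fullIO_nil]
    | cons y x ih =>
      obtain ⟨r', hr⟩ := ih (.chr y :: b) (some (.chr y), r.2)
      have e : ((y :: x).map Sym.chr).reverse ++ b = (x.map Sym.chr).reverse ++ .chr y :: b := by simp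
      rw [e]
      refine ⟨r', .loop_blk_more (S' := (_, _)) ?_ ?_ hr⟩
      · simp [paramInput, exec_popInp, exec_push', inSym, isMark]
      · rfl
  | succ k ih =>
    obtain ⟨r', hr⟩ := ih (.mark :: u) (some .mark, r.2)
    have e : List.replicate (k + 1) Sym.mark ++ u = List.replicate k .mark ++ .mark :: u := by
      rw [List.replicate_succ']; simp
    rw [e, show 2 * (k + 1 + x.length) + 2 = 2 * (k + x.length) + 2 + 2 by omega]
    refine ⟨r', .loop_blk_more (S' := (_, _)) ?_ ?_ hr⟩
    · simp [paramInput, exec_popInp, exec_push', inSym, isMark, List.replicate_succ]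
    · rfl

/-- Turn the parameter on the stack `u` into a list on the main stack. -/
def unaryLoop : Program :=
  .loop (.blk (pop .u (fun r s => (s, r.2)) (branch (fun r => r.1.isSome)
    (push .a (fun _ => .cut) (push .a (fun _ => .mark) done)) done))) fun r => r.1.isSome

theorem runW_unaryLoop (k : ℕ) (vs : List V) (a : List Sym) :
    RunW unaryLoop (tp ((V.list vs).enc ++ a) [] [] [] [] [] (List.replicate k .mark))
      (st ((V.list (List.replicate k (.atom []) ++ vs)).enc ++ a)) (2 * k + 2) := by
  intro r
  suffices H : ∃ r', Run unaryLoop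
      (r, full (tp ((V.list vs).enc ++ a) [] [] [] [] [] (List.replicate k .mark))) (2 * k + 2)
      (r', full (st ((V.list (List.replicate k (.atom []) ++ vs)).enc ++ a))) by
    obtain ⟨r', hr⟩ := H
    exact ⟨r', _, le_rfl, hr⟩
  induction k generalizing vs r with
  | zero =>
    refine ⟨(none, r.2), .loop_blk_done ?_ rfl⟩
    simp [st]
  | succ k ih =>
    obtain ⟨r', hr⟩ := ih (.atom [] :: vs) (some .mark, r.2)
    have e : List.replicate (k + 1) (atom []) ++ vs = List.replicate k (.atom []) ++ .atom [] :: vs := by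
      rw [List.replicate_succ']; simp
    rw [e]
    refine ⟨r', .loop_blk_more (S' := (_, _)) ?_ ?_ hr⟩
    · simp [List.replicate_succ, V.list, enc]
    · rfl

/-- Turn the input into a tree on the main stack. -/
def readProg : Program :=
  .seq readLoop (.seq (.blk (push .a (fun _ => .cut) done)) (.seq (moveAll .b .a)
    (.seq (.blk (push .a (fun _ => .cut) done)) (.seq unaryLoop putMark))))

theorem run_readProg (k : ℕ) (x : List RatSym) (r : Reg) :
    ∃ r' t, t ≤ 4 * k + 4 * x.length + 9 ∧ Run readProg (r, fullIO (paramInput x k) [] fun _ => []) t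
      (r', full (st ((V.pair (V.list (List.replicate k (.atom []))) (.atom x)).enc))) := by
  obtain ⟨r₁, hr₁⟩ := run_readLoop k x [] [] r
  have h₁ : RunW (.blk (push .a (fun _ => .cut) done))
    (tp [] (x.map .chr).reverse [] [] [] [] (List.replicate k .mark))
    (tp [.cut] (x.map .chr).reverse [] [] [] [] (List.replicate k .mark)) _ :=
    .blk fun r => ⟨r, by simp⟩
  have h₂ : RunW (moveAll .b .a)
    (tp [.cut] (x.map .chr).reverse [] [] [] [] (List.replicate k .mark))
    (tp (atom x).enc [] [] [] [] [] (List.replicate k .mark)) _ :=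
    runW_moveAll (by decide) (by simp [enc])
  have h₃ : RunW (.blk (push .a (fun _ => .cut) done))
    (tp (atom x).enc [] [] [] [] [] (List.replicate k .mark))
    (tp ((V.list []).enc ++ (atom x).enc) [] [] [] [] [] (List.replicate k .mark)) _ :=
    .blk fun r => ⟨r, by simp [V.list, enc]⟩
  have h₄ := runW_unaryLoop k [] (atom x).enc
  have h₅ := runW_putMark ((V.list (List.replicate k (.atom []) ++ [])).enc ++ (atom x).enc)
  obtain ⟨r₂, t, ht, hr₂⟩ := h₁.seq (h₂.seq (h₃.seq (h₄.seq h₅))) r₁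
  simp only [List.append_nil] at hr₁ hr₂
  refine ⟨r₂, 2 * (k + x.length) + 2 + t, ?_, .seq ?_ hr₂⟩
  · simp at ht
    omega
  · have e : (fun _ => [] : W → List Sym) = tp [] [] [] [] [] [] [] := by
      funext i; cases i <;> rfl
    rw [e]
    exact hr₁

/-- Write the result, and reset the registers. -/
def writeProg : Program :=
  .blk (pop .a (fun r s => (s, r.2)) (branch (fun r => isStop r.1)
    (pushOut false (load (fun _ => (none, none, false)) done))
    (pop .a (fun r _ => r)
      (pushOut true (load (fun _ => (none, none, false)) done)))))

theorem run_writeProg (x : Bool) (r : Reg) :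
    Run writeProg (r, full (st (flag x).enc)) 1 ((none, none, false), fullIO [] [x] fun _ => []) := by
  have e' : (fun _ => [] : W → List Sym) = st [] := by
    funext i; cases i <;> rfl
  have e : ((none, none, false), fullIO [] [x] fun _ => []) = exec
      (pop .a (fun r s => (s, r.2)) (branch (fun r => isStop r.1)
      (pushOut false (load (fun _ => (none, none, false)) done))
      (pop .a (fun r _ => r) (pushOut true (load (fun _ => (none, none, false)) done)))))
      (r, full (st (flag x).enc)) := by
    rw [e']
    cases x
    · simp only [flag, enc, st, isStop, exec_pop, exec_branch]
      simp [← fullIO_nil, exec_pushOut]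
    · simp only [flag, enc, st, isStop, exec_pop, exec_branch]
      simp [← fullIO_nil, exec_pushOut]
  rw [e]
  exact Run.blk _ _

/-- The machine that runs a program on its input. -/
noncomputable def machine (P : Program) : FinTM2 :=
  let Q : Program := .seq readProg (.seq P writeProg)
  { K := Stk
    kFin := inferInstance
    k₀ := .inp
    k₁ := .out
    Γ := Alph
    Λ := Option Q.Lab
    ΛFin := Fintype.ofFinite _
    main := some Q.entry
    σ := Reg
    σFin := Fintype.ofFinite _
    Γk₀Fin := Fintype.ofFinite (Option RatSym)
    initialState := (none, none, false)
    -- The additional label `none` is the exit of the program, where the machine halts.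
    m := fun l => l.elim .halt (Q.code some none) }

theorem initList_machine (P : Program) (l : List (Option RatSym)) :
    initList (machine P) l = ⟨(machine P).main, (none, none, false), fullIO l [] fun _ => []⟩ := by
  have e : (initList (machine P) l).stk = fullIO l [] fun _ => [] := by
    funext k; cases k <;> rfl
  rw [← e]
  rfl

theorem haltList_machine (P : Program) (l : List Bool) :
    haltList (machine P) l = ⟨none, (none, none, false), fullIO [] l fun _ => []⟩ := by
  have e : (haltList (machine P) l).stk = fullIO [] l fun _ => [] := by
    funext k; cases k <;> rfl
  rw [← e]
  rfl

theorem machine_outputs {P : Program} {x : List RatSym} {k : ℕ} {b : Bool} {n : ℕ}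
    (h : Realizes P (V.pair (V.list (List.replicate k (.atom []))) (.atom x)) (flag b) n) :
    Nonempty (TM2OutputsInTime (machine P) (paramInput x k) (some [b])
      (4 * k + 4 * x.length + n + 11)) := by
  obtain ⟨r₁, t₁, ht₁, h₁⟩ := run_readProg k x (none, none, false)
  obtain ⟨r₂, t₂, ht₂, h₂⟩ := h [] r₁
  simp only [List.append_nil] at h₂
  have h₃ := h₁.seq (h₂.seq (run_writeProg b r₂))
  have h₄ := h₃.steps (machine P).m some none fun l => rfl
  -- The extra step executes `.halt` at the exit label.
  have h₅ := stepsFrom_add h₄ (stepsFrom_one _ _ _)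
  refine ⟨⟨⟨t₁ + (t₂ + 1) + 1, ?_⟩, by dsimp only; omega⟩⟩
  rw [initList_machine]
  refine h₅.trans ?_
  exact congrArg some (haltList_machine P [b]).symm

open Classical in
/-- A parameterized language with a feasible characteristic function is fixed-parameter
tractable. -/
theorem Feasible.isFPT {L : Set (List RatSym × ℕ)} {f : List Unit × Str → Bool} (hf : Feasible f)
    (h : ∀ x k, (x, k) ∈ L ↔ f (List.replicate k (), ⟨x⟩) = true) : IsFPT L := by
  obtain ⟨P, g, pg, mg, hP⟩ := hf
  -- The summand `4 * k + 15` pays for reading the input and writing the answer.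
  refine ⟨⟨machine P, Equiv.refl _, Equiv.refl _⟩, fun k => g (2 * k + 3) + 4 * k + 15,
    (Polynomial.X + 1) ^ 2, ?_, fun x k => ?_⟩
  · exact (Primrec.nat_add.comp (Primrec.nat_add.comp (pg.comp (Primrec.nat_add.comp
      (Primrec.nat_mul.comp (Primrec.const _) Primrec.id) (Primrec.const _)))
      (Primrec.nat_mul.comp (Primrec.const _) Primrec.id)) (Primrec.const _)).to_comp
  · have hr : ∀ k, rep (V.list (List.replicate k (.atom []))) (List.replicate k ()) := by
      intro k
      induction k with
      | zero => rfl
      | succ k ih => exact ⟨_, _, rfl, rfl, ih⟩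
    have hs : ∀ k, (V.list (List.replicate k (.atom []))).size = 2 * k + 1 := by
      intro k
      induction k with
      | zero => rfl
      | succ k ih => simp [List.replicate_succ, V.list, ih]; ring
    have hn : ∀ k, (V.list (List.replicate k (.atom []))).nodes = k := by
      intro k
      induction k with
      | zero => rfl
      | succ k ih => simp [List.replicate_succ, V.list, nodes, ih]
    -- The input tree has `k + 1` nodes and length `2 * k + 3 + |x|`, which is at most `(2 * k + 3)
    -- * (|x| + 1)`.
    obtain ⟨w, hw, -, h'⟩ := hP (2 * k + 3) x.length
      (V.pair (V.list (List.replicate k (.atom []))) (.atom x)) (List.replicate k (), ⟨x⟩)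
      ⟨_, _, rfl, hr k, rfl⟩ ⟨by simp only [nodes, hn]; omega, by rw [size_pair, hs, size_atom]; nlinarith⟩
    cases hw
    have e : decide ((x, k) ∈ L) = f (List.replicate k (), ⟨x⟩) := by
      rw [Bool.eq_iff_iff, decide_eq_true_iff, h]
    obtain ⟨H⟩ := machine_outputs h'
    have H' : Nonempty (TM2OutputsInTime (machine P) (paramInput x k)
        (Option.some [decide ((x, k) ∈ L)])
        ((g (2 * k + 3) + 4 * k + 15) * ((Polynomial.X + 1) ^ 2 : Polynomial ℕ).eval x.length)) := by
      rw [e]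
      refine ⟨⟨H.toEvalsTo, H.steps_le_m.trans ?_⟩⟩
      simp only [Polynomial.eval_pow, Polynomial.eval_add, Polynomial.eval_X, Polynomial.eval_one]
      have h₁ : x.length + 1 ≤ (x.length + 1) ^ 2 := Nat.le_self_pow two_ne_zero _
      have h₂ := Nat.mul_le_mul_left (4 * k) (show 1 ≤ (x.length + 1) ^ 2 by omega)
      rw [add_mul, add_mul]
      omega
    exact (congrArg (fun l : List (Option RatSym) => Nonempty (TM2OutputsInTime (machine P) l
      (Option.some [decide ((x, k) ∈ L)]) _)) (List.map_id' (paramInput x k))).mpr H'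

end StackProg

/-! ### The decision procedure and its feasibility. -/

namespace StackProg

open V StackProg.Rep

variable {α β γ δ : Type} [Rep α] [Rep β] [Rep γ] [Rep δ]

/-- Is the symbol a minus sign? -/
def isMinus : RatSym → Bool
  | .minus => true
  | _ => false

/-- Is the symbol a fraction bar? -/
def isSlash : RatSym → Bool
  | .slash => true
  | _ => false

/-- Is the symbol a comma? -/
def isComma : RatSym → Bool
  | .comma => true
  | _ => false

/-- Read an optional minus sign. -/
def parseSign (s : Str) : Bool × Str :=
  if starts isMinus s then (true, ⟨s.str.tail⟩) else (false, s)

/-- Read an unsigned fraction and a comma, when the sign is known. -/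
def parseFrac (z : Bool × Str) : Option (ℚ × Str) :=
  if starts isSlash (takeNat z.2).2 && (decide (0 < (takeNat ⟨(takeNat z.2).2.str.tail⟩).1) &&
      starts isComma (takeNat ⟨(takeNat z.2).2.str.tail⟩).2) then
    some (if z.1 then -(((takeNat z.2).1 : ℚ) / (takeNat ⟨(takeNat z.2).2.str.tail⟩).1)
        else ((takeNat z.2).1 : ℚ) / (takeNat ⟨(takeNat z.2).2.str.tail⟩).1,
      ⟨(takeNat ⟨(takeNat z.2).2.str.tail⟩).2.str.tail⟩)
  else none

/-- Read a fraction and a comma. -/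
def parseNum (s : Str) : Option (ℚ × Str) := parseFrac (parseSign s)

/-- Read as many items as `u` has elements. -/
def parseMany {β : Type} (parse : Str → Option (β × Str)) (u : List Unit) (s : Str) :
    Option (List β × Str) :=
  u.foldl (fun o _ => o.bind fun z => (parse z.2).bind fun y => some (z.1 ++ [y.1], y.2))
    (some ([], s))

/-- The inner product of two vectors. -/
def dot (x y : List ℚ) : ℚ := (x.zipWith (fun a b => a * b) y).sum

/-- A multiple of the component of `x` orthogonal to `y`. -/
def reduce (x y : List ℚ) : List ℚ := x.zipWith (fun a b => dot y y * a + -(dot x y * b)) y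

/-- Orthogonalization without division; `none` if the vectors are linearly dependent. -/
def orthogonalize (l : List (List ℚ)) : Option (List (List ℚ)) :=
  l.foldl (fun o v => o.bind fun ws =>
    if decide (0 < dot (ws.foldl reduce v) (ws.foldl reduce v)) then
      some (ws.foldl reduce v :: ws) else none) (some [])

/-- The sums of one of the two multiples of each vector, and the vector `z`. -/
def vertices (lo hi : ℚ) (z : List ℚ) (l : List (List ℚ)) : List (List ℚ) :=
  l.foldl (fun S v => S.flatMap fun x =>
    [x.zipWith (fun a b => a + lo * b) v, x.zipWith (fun a b => a + hi * b) v]) [z]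

/-- The sum of the `p`-th powers of the coordinates. -/
def normPow (p : ℕ) (x : List ℚ) : ℚ := (x.map fun a => |a| ^ p).sum

/-- The decision procedure: `u` has as many elements as there are vectors. -/
def decideParmax (p : ℕ) (lo hi : ℚ) (u : List Unit) (s : Str) : Bool :=
  ((parseNum s).bind fun y => (parseMany (parseMany parseNum u) u y.2).bind fun z =>
    some ((y.1, u.map fun _ => (0 : ℚ)), z)).elim false fun w =>
      -- `w.1.2` is the zero vector of length `d`, so the first test is `1 ≤ d`; the second one
      -- requires that the whole string has been consumed.
      (!w.1.2.isEmpty && !(!w.2.2.str.isEmpty)) && (((orthogonalize w.2.1).elim false fun _ => true) &&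
        (vertices lo hi w.1.2 w.2.1).any fun x => !decide (normPow p x < w.1.1))

namespace Feasible

theorem parseNum {s : α → Str} (hs : Feasible s) : Feasible fun x => parseNum (s x) := by
  have h₁ : Feasible parseSign :=
    (starts isMinus .id).ite ((bool true).pair (strTail .id)) ((bool false).pair .id)
  have a : Feasible fun z : Bool × Str => StackProg.takeNat z.2 := takeNat snd
  have b : Feasible fun z : Bool × Str =>
    StackProg.takeNat ⟨(StackProg.takeNat z.2).2.str.tail⟩ := takeNat (strTail (snd.comp a))
  have q := ratDiv (fst.comp a) (fst.comp b)
  have h₂ : Feasible parseFrac :=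
    ((starts isSlash (snd.comp a)).and ((natLt (natConst 0) (fst.comp b)).and
      (starts isComma (snd.comp b)))).ite
      ((fst.ite q.ratNeg q).pair (strTail (snd.comp b))).some none
  exact h₂.comp (h₁.comp hs)

theorem parseMany {parse : α × Str → Option (β × Str)} (hp : Feasible parse)
    {u : α → List Unit} (hu : Feasible u) {s : α → Str} (hs : Feasible s) :
    Feasible fun x => parseMany (fun t => parse (x, t)) (u x) (s x) := by
  have h₁ : Feasible fun w : ((α × (Option (List β × Str) × Unit)) × (List β × Str)) × (β × Str) =>
      Option.some (w.1.2.1 ++ [w.2.1], w.2.2) :=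
    (((fst.comp (snd.comp fst)).append ((fst.comp snd).cons nil)).pair (snd.comp snd)).some
  have h₂ : Feasible fun w : (α × (Option (List β × Str) × Unit)) × (List β × Str) =>
      (parse (w.1.1, w.2.2)).bind fun y => Option.some (w.2.1 ++ [y.1], y.2) :=
    optionBind h₁ (hp.comp₂ (fst.comp fst) (snd.comp snd))
  have h₃ : Feasible fun w : α × (Option (List β × Str) × Unit) =>
      w.2.1.bind fun z => (parse (w.1, z.2)).bind fun y => Option.some (z.1 ++ [y.1], y.2) :=
    optionBind h₂ (fst.comp snd)
  exact foldl h₃ (nil.pair hs).some hu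

theorem dot {f h : α → List ℚ} (hf : Feasible f) (hh : Feasible h) :
    Feasible fun x => dot (f x) (h x) :=
  ratSum (zipWith (f := fun z : α × (ℚ × ℚ) => z.2.1 * z.2.2)
    ((fst.comp snd).ratMul (snd.comp snd)) hf hh)

theorem reduce {f h : α → List ℚ} (hf : Feasible f) (hh : Feasible h) :
    Feasible fun x => reduce (f x) (h x) :=
  zipWith (f := fun z : α × (ℚ × ℚ) => StackProg.dot (h z.1) (h z.1) * z.2.1 +
      -(StackProg.dot (f z.1) (h z.1) * z.2.2))
    (((dot (hh.comp fst) (hh.comp fst)).ratMul (fst.comp snd)).ratAdd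
      ((dot (hf.comp fst) (hh.comp fst)).ratMul (snd.comp snd)).ratNeg) hf hh

theorem orthogonalize {l : α → List (List ℚ)} (hl : Feasible l) :
    Feasible fun x => orthogonalize (l x) := by
  have h₁ : Feasible fun w : (α × (Option (List (List ℚ)) × List ℚ)) × List (List ℚ) =>
      w.2.foldl StackProg.reduce w.1.2.2 :=
    foldl (f := fun z : ((α × (Option (List (List ℚ)) × List ℚ)) × List (List ℚ)) ×
      (List ℚ × List ℚ) => StackProg.reduce z.2.1 z.2.2)
      (reduce (fst.comp snd) (snd.comp snd)) (snd.comp (snd.comp fst)) snd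
  have h₂ : Feasible fun w : (α × (Option (List (List ℚ)) × List ℚ)) × List (List ℚ) =>
      if decide (0 < StackProg.dot (w.2.foldl StackProg.reduce w.1.2.2)
        (w.2.foldl StackProg.reduce w.1.2.2)) then
      Option.some (w.2.foldl StackProg.reduce w.1.2.2 :: w.2) else Option.none :=
    (ratLt ((ratConst 0).of_eq fun _ => Nat.cast_zero) (dot h₁ h₁)).ite (h₁.cons snd).some none
  exact foldl (optionBind h₂ (fst.comp snd)) nil.some hl

theorem vertices (lo hi : ℚ) (hlo : Feasible fun _ : Unit => lo) (hhi : Feasible fun _ : Unit => hi)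
    {z : α → List ℚ} (hz : Feasible z) {l : α → List (List ℚ)} (hl : Feasible l) :
    Feasible fun x => vertices lo hi (z x) (l x) := by
  have h₁ (r : ℚ) (hr : Feasible fun _ : Unit => r) :
      Feasible fun w : (α × (List (List ℚ) × List ℚ)) × List ℚ =>
        w.2.zipWith (fun a b => a + r * b) w.1.2.2 :=
    zipWith (f := fun w : ((α × (List (List ℚ) × List ℚ)) × List ℚ) × (ℚ × ℚ) =>
        w.2.1 + r * w.2.2)
      ((fst.comp snd).ratAdd ((hr.comp unit).ratMul (snd.comp snd))) snd (snd.comp (snd.comp fst))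
  exact foldl (f := fun w : α × (List (List ℚ) × List ℚ) => w.2.1.flatMap fun x =>
      [x.zipWith (fun a b => a + lo * b) w.2.2, x.zipWith (fun a b => a + hi * b) w.2.2])
    (flatMap ((h₁ lo hlo).cons ((h₁ hi hhi).cons nil)) (fst.comp snd)) (hz.cons nil) hl

theorem listIsEmpty {l : α → List β} (hl : Feasible l) : Feasible fun x => (l x).isEmpty :=
  (listCase (f := fun _ => false) (bool false) (bool true) hl).of_eq fun x => by
    cases l x <;> rfl

theorem normPow (p : ℕ) {f : α → List ℚ} (hf : Feasible f) : Feasible fun x => normPow p (f x) :=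
  ratSum (map (f := fun z : α × ℚ => |z.2| ^ p) (snd.ratAbs.ratPow p) hf)

theorem decideParmax (p : ℕ) (lo hi : ℚ) (hlo : Feasible fun _ : Unit => lo)
    (hhi : Feasible fun _ : Unit => hi) :
    Feasible fun x : List Unit × Str => decideParmax p lo hi x.1 x.2 := by
  have h₁ : Feasible fun w : (List Unit × Str) × (ℚ × Str) =>
      StackProg.parseMany (StackProg.parseMany StackProg.parseNum w.1.1) w.1.1 w.2.2 :=
    parseMany (parse := fun z : ((List Unit × Str) × (ℚ × Str)) × Str =>
      StackProg.parseMany StackProg.parseNum z.1.1.1 z.2)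
      (parseMany (parse := fun z : (((List Unit × Str) × (ℚ × Str)) × Str) × Str =>
        StackProg.parseNum z.2) (parseNum snd) (fst.comp (fst.comp fst)) snd)
      (fst.comp fst) (snd.comp snd)
  have h₂ : Feasible fun w : ((List Unit × Str) × (ℚ × Str)) × (List (List ℚ) × Str) =>
      Option.some ((w.1.2.1, w.1.1.1.map fun _ => (0 : ℚ)), w.2) :=
    (((fst.comp (snd.comp fst)).pair (map (f := fun _ => (0 : ℚ))
      ((ratConst 0).of_eq fun _ => Nat.cast_zero) (fst.comp (fst.comp fst)))).pair snd).some
  have h₃ := optionBind (optionBind h₂ h₁) (parseNum (snd (α := List Unit)))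
  have h₄ : Feasible fun w : (List Unit × Str) × ((ℚ × List ℚ) × (List (List ℚ) × Str)) =>
      (!w.2.1.2.isEmpty && !(!w.2.2.2.str.isEmpty)) &&
      (((StackProg.orthogonalize w.2.2.1).elim false fun _ => true) &&
      (StackProg.vertices lo hi w.2.1.2 w.2.2.1).any fun x =>
        !decide (StackProg.normPow p x < w.2.1.1)) :=
    ((listIsEmpty (snd.comp (fst.comp snd))).not.and
      (strNonempty (snd.comp (snd.comp snd))).not).and
    ((optionElim (f := fun _ => true) (bool true) (bool false)
      (orthogonalize (fst.comp (snd.comp snd)))).and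
    (any (f := fun z : ((List Unit × Str) × ((ℚ × List ℚ) × (List (List ℚ) × Str))) × List ℚ =>
      !decide (StackProg.normPow p z.2 < z.1.2.1.1))
      (ratLt (normPow p snd) (fst.comp (fst.comp (snd.comp fst)))).not
      (vertices lo hi hlo hhi (snd.comp (fst.comp snd)) (fst.comp (snd.comp snd)))))
  exact optionElim h₄ (bool false) h₃

end Feasible

end StackProg

/-! ### Correctness of the parser. -/

namespace StackProg

theorem takeNat_append (a : List Bool) (y : RatSym) (hy : isBit y = false) (u : List RatSym) :
    takeNat ⟨a.map .bit ++ y :: u⟩ = (binVal a, ⟨y :: u⟩) := by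
  have h₁ : (a.map RatSym.bit ++ y :: u).takeWhile isBit = a.map .bit := by
    induction a with
    | nil => simp [hy]
    | cons b a ih => simp [List.takeWhile_cons, isBit, ih]
  have h₂ : (a.map RatSym.bit ++ y :: u).dropWhile isBit = y :: u := by
    clear h₁
    induction a with
    | nil => simp [hy]
    | cons b a ih => simp [List.dropWhile_cons, isBit, ih]
  have h₃ : (a.map RatSym.bit).map bitVal = a := by
    rw [List.map_map]
    exact (List.map_congr_left fun b _ => rfl).trans (List.map_id a)
  simp only [takeNat, h₁, h₂, h₃]

theorem exists_of_takeNat (s : Str) :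
    ∃ a : List Bool, s.str = a.map .bit ++ (takeNat s).2.str ∧ binVal a = (takeNat s).1 := by
  refine ⟨(s.str.takeWhile isBit).map bitVal, ?_, rfl⟩
  conv_lhs => rw [← List.takeWhile_append_dropWhile (p := isBit) (l := s.str)]
  rw [takeNat, List.map_map]
  congr 1
  refine (List.map_id _).symm.trans (List.map_congr_left fun x hx => ?_)
  have := List.mem_takeWhile_imp hx
  cases x <;> simp_all [isBit, bitVal]

theorem starts_iff {q : RatSym → Bool} {y : RatSym} (hq : ∀ x, q x = true ↔ x = y) (s : Str) :
    starts q s = true ↔ s.str = y :: s.str.tail := by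
  obtain ⟨s⟩ := s
  cases s with
  | nil => simp [starts]
  | cons x s =>
    by_cases h : q x = true
    · obtain rfl := (hq x).1 h
      simp [starts, h]
    · have : ¬ x = y := fun e => h ((hq x).2 e)
      simp [starts, h, this]

theorem isMinus_iff (x : RatSym) : isMinus x = true ↔ x = .minus := by cases x <;> simp [isMinus]

theorem isSlash_iff (x : RatSym) : isSlash x = true ↔ x = .slash := by cases x <;> simp [isSlash]

theorem isComma_iff (x : RatSym) : isComma x = true ↔ x = .comma := by cases x <;> simp [isComma]

/-- `parse` finds the prefixes related to a value by `R`. -/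
def Parses {β : Type} (parse : Str → Option (β × Str)) (R : List RatSym → β → Prop) : Prop :=
  ∀ s r t, parse s = some (r, t) ↔ ∃ g, R g r ∧ s.str = g ++ t.str

theorem parseFrac_eq_some (neg : Bool) (s : Str) (r : ℚ) (t : Str) :
    parseFrac (neg, s) = some (r, t) ↔ ∃ a b : List Bool,
      s.str = a.map .bit ++ .slash :: (b.map .bit ++ .comma :: t.str) ∧ binVal b ≠ 0 ∧
      r = (if neg then -1 else 1) * ((binVal a : ℚ) / binVal b) := by
  constructor
  · intro h
    unfold parseFrac at h
    split at h
    · rename_i hc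
      simp only [Bool.and_eq_true, decide_eq_true_iff, starts_iff isSlash_iff,
        starts_iff isComma_iff] at hc
      obtain ⟨h₁, h₂, h₃⟩ := hc
      obtain ⟨a, ha, hva⟩ := exists_of_takeNat s
      obtain ⟨b, hb, hvb⟩ := exists_of_takeNat ⟨(takeNat s).2.str.tail⟩
      simp only [Option.some.injEq, Prod.mk.injEq] at h
      obtain ⟨hr, ht⟩ := h
      refine ⟨a, b, ?_, by rw [hvb]; omega, ?_⟩
      · rw [ha, h₁]
        dsimp only at hb
        rw [hb, h₃, ← ht]
      · rw [← hr, hva, hvb]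
        cases neg <;> simp
    · exact absurd h (by simp)
  · rintro ⟨a, b, hs, hb, hr⟩
    obtain ⟨s⟩ := s
    dsimp only at hs
    subst hs
    have h₁ := takeNat_append a .slash rfl (b.map .bit ++ .comma :: t.str)
    have h₂ := takeNat_append b .comma rfl t.str
    have hb' : 0 < binVal b := Nat.pos_of_ne_zero hb
    simp only [parseFrac, h₁, List.tail_cons, h₂]
    rw [(starts_iff isSlash_iff _).2 rfl, (starts_iff isComma_iff _).2 rfl, hr]
    cases neg <;> simp [hb']

/-- The equivalence includes unambiguity: neither the fraction bar nor the comma is a digit, so the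
maximal runs of digits are the only possible ones, and a leading minus can only be the sign. -/
theorem parses_parseNum : Parses parseNum fun g r => ∃ g', DenotesRat g' r ∧ g = g' ++ [.comma] := by
  intro s r t
  unfold parseNum parseSign
  by_cases hs : starts isMinus s = true
  · rw [if_pos hs, parseFrac_eq_some]
    rw [starts_iff isMinus_iff] at hs
    constructor
    · rintro ⟨a, b, h, hb, hr⟩
      dsimp only at h
      exact ⟨_, ⟨_, ⟨true, a, b, rfl, hb, hr⟩, rfl⟩, by rw [hs, h]; simp⟩
    · rintro ⟨_, ⟨_, ⟨neg, a, b, rfl, hb, hr⟩, rfl⟩, h⟩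
      rw [hs] at h
      cases neg
      · cases a <;> simp at h
      · refine ⟨a, b, ?_, hb, hr⟩
        simpa using h
  · rw [if_neg hs, parseFrac_eq_some]
    rw [starts_iff isMinus_iff] at hs
    constructor
    · rintro ⟨a, b, h, hb, hr⟩
      exact ⟨_, ⟨_, ⟨false, a, b, rfl, hb, hr⟩, rfl⟩, by rw [h]; simp⟩
    · rintro ⟨_, ⟨_, ⟨neg, a, b, rfl, hb, hr⟩, rfl⟩, h⟩
      cases neg
      · exact ⟨a, b, by simpa using h, hb, hr⟩
      · exact absurd (by simp [h]) hs

/-- Reading item by item loses nothing: by `h`, the first item of any admissible decomposition of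
the string must be the one that `parse` returns. A failure persists through the fold (`hnone`). -/
theorem Parses.many {β : Type} {parse : Str → Option (β × Str)} {R : List RatSym → β → Prop}
    (h : Parses parse R) (u : List Unit) :
    Parses (parseMany parse u) fun g l =>
      ∃ gs, List.Forall₂ R gs l ∧ l.length = u.length ∧ g = gs.flatten := by
  have hnone : ∀ u : List Unit, u.foldl (fun o _ => o.bind fun z => (parse z.2).bind fun y =>
      some (z.1 ++ [y.1], y.2)) (none : Option (List β × Str)) = none := by
    intro u
    induction u with
    | nil => rfl
    | cons _ u ih => simpa using ih
  have H : ∀ (u : List Unit) (m : List β) (s : Str) (l : List β) (t : Str),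
      u.foldl (fun o _ => o.bind fun z => (parse z.2).bind fun y =>
        some (z.1 ++ [y.1], y.2)) (some (m, s)) = some (l, t) ↔
      ∃ l' gs, l = m ++ l' ∧ List.Forall₂ R gs l' ∧ l'.length = u.length ∧
        s.str = gs.flatten ++ t.str := by
    intro u
    induction u with
    | nil =>
      intro m s l t
      obtain ⟨s⟩ := s
      obtain ⟨t⟩ := t
      constructor
      · intro h
        simp only [List.foldl_nil, Option.some.injEq, Prod.mk.injEq, Str.mk.injEq] at h
        exact ⟨[], [], by simp [h], .nil, rfl, by simp [h]⟩
      · rintro ⟨l', gs, rfl, h', hl, hs⟩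
        obtain rfl : l' = [] := List.length_eq_zero_iff.1 hl
        cases h'
        simp_all
    | cons _ u ih =>
      intro m s l t
      rw [List.foldl_cons, Option.bind_some]
      cases hp : parse s with
      | none =>
        rw [Option.bind_none, hnone]
        refine iff_of_false (by simp) ?_
        rintro ⟨l', gs, rfl, h', hl, hs⟩
        cases h' with
        | nil => simp at hl
        | @cons g r gs l' hg h' =>
          have := (h s r ⟨gs.flatten ++ t.str⟩).2 ⟨g, hg, by simpa using hs⟩
          simp [hp] at this
      | some y =>
        rw [Option.bind_some, ih]
        obtain ⟨g₀, hg₀, hs₀⟩ := (h s y.1 y.2).1 hp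
        constructor
        · rintro ⟨l', gs, rfl, h', hl, hs⟩
          exact ⟨y.1 :: l', g₀ :: gs, by simp, .cons hg₀ h', by simp [hl], by simp [hs₀, hs]⟩
        · rintro ⟨l', gs, rfl, h', hl, hs⟩
          cases h' with
          | nil => simp at hl
          | @cons g r gs l' hg h' =>
            have := (h s r ⟨gs.flatten ++ t.str⟩).2 ⟨g, hg, by simpa using hs⟩
            rw [hp] at this
            obtain rfl : y = _ := Option.some.inj this
            exact ⟨l', gs, by simp, h', by simpa using hl, rfl⟩
  intro s r t
  refine (H u [] s r t).trans ?_
  constructor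
  · rintro ⟨l', gs, rfl, h', hl, hs⟩
    exact ⟨_, ⟨gs, h', hl, rfl⟩, hs⟩
  · rintro ⟨_, ⟨gs, h', hl, rfl⟩, hs⟩
    exact ⟨r, gs, rfl, h', hl, hs⟩

theorem exists_ofFn {β : Type} {l : List β} {d : ℕ} (h : l.length = d) :
    ∃ f : Fin d → β, l = List.ofFn f := by
  subst h
  exact ⟨l.get, (List.ofFn_get l).symm⟩

theorem forall₂_ofFn {β γ : Type} {R : β → γ → Prop} {d : ℕ} (f : Fin d → β) (g : Fin d → γ) :
    List.Forall₂ R (List.ofFn f) (List.ofFn g) ↔ ∀ i, R (f i) (g i) := by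
  rw [List.forall₂_iff_get]
  simp only [List.length_ofFn, true_and, List.get_ofFn]
  exact ⟨fun h i => h i i.2 i.2, fun h i h₁ _ => h ⟨i, h₁⟩⟩

theorem many_ofFn {β : Type} {R : List RatSym → β → Prop} {u : List Unit} {d : ℕ}
    (hu : u.length = d) (g : List RatSym) (f : Fin d → β) :
    (∃ gs, List.Forall₂ R gs (List.ofFn f) ∧ (List.ofFn f).length = u.length ∧ g = gs.flatten) ↔
      ∃ w : Fin d → List RatSym, (∀ i, R (w i) (f i)) ∧ g = (List.ofFn w).flatten := by
  constructor
  · rintro ⟨gs, h, -, rfl⟩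
    obtain ⟨w, rfl⟩ := exists_ofFn (h.length_eq.trans (List.length_ofFn))
    exact ⟨w, (forall₂_ofFn w f).1 h, rfl⟩
  · rintro ⟨w, h, rfl⟩
    exact ⟨_, (forall₂_ofFn w f).2 h, by simp [hu], rfl⟩

theorem length_of_many {β : Type} {R : List RatSym → β → Prop} {u : List Unit} {g : List RatSym}
    {l : List β} (h : ∃ gs, List.Forall₂ R gs l ∧ l.length = u.length ∧ g = gs.flatten) :
    l.length = u.length := by
  obtain ⟨gs, -, h, -⟩ := h
  exact h

/-- Parsing succeeds exactly for encoded instances. -/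
theorem encodesInstance_iff {d : ℕ} {u : List Unit} (hu : u.length = d) (x : List RatSym) (γ : ℚ)
    (v : Fin d → Fin d → ℚ) : EncodesInstance x γ v ↔
      ∃ t, parseNum ⟨x⟩ = some (γ, t) ∧ parseMany (parseMany parseNum u) u t =
        some (List.ofFn fun i => List.ofFn (v i), ⟨[]⟩) := by
  have key : ∀ t, parseMany (parseMany parseNum u) u t =
      some (List.ofFn fun i => List.ofFn (v i), ⟨[]⟩) ↔
      ∃ w : Fin d → Fin d → List RatSym, (∀ i j, DenotesRat (w i j) (v i j)) ∧ t.str =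
        (List.ofFn fun i => (List.ofFn fun j => w i j ++ [RatSym.comma]).flatten).flatten := by
    intro t
    rw [(parses_parseNum.many u).many u]
    simp only [many_ofFn hu, List.append_nil]
    constructor
    · rintro ⟨_, ⟨w, hw, rfl⟩, ht⟩
      choose w' hw' e using hw
      choose w'' hw'' e' using hw'
      refine ⟨w'', hw'', ?_⟩
      rw [ht]
      congr 2
      funext i
      rw [e]
      congr 2
      funext j
      exact e' i j
    · rintro ⟨w, hw, ht⟩
      exact ⟨_, ⟨_, fun i => ⟨_, fun j => ⟨_, hw i j, rfl⟩, rfl⟩, rfl⟩, ht⟩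
  simp only [key]
  constructor
  · rintro ⟨g, w, hg, hw, rfl⟩
    refine ⟨⟨_⟩, (parses_parseNum _ _ _).2 ⟨_, ⟨g, hg, rfl⟩, rfl⟩, w, hw, rfl⟩
  · rintro ⟨t, ht, w, hw, e⟩
    obtain ⟨_, ⟨g, hg, rfl⟩, hx⟩ := (parses_parseNum _ _ _).1 ht
    exact ⟨g, w, hg, hw, by rw [← e]; exact hx⟩

/-- Needed for soundness: the lists returned by a successful run have the dimensions of a square
matrix. -/
theorem exists_of_parseMany {d : ℕ} {u : List Unit} (hu : u.length = d) {t t' : Str}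
    {l : List (List ℚ)} (h : parseMany (parseMany parseNum u) u t = some (l, t')) :
    ∃ v : Fin d → Fin d → ℚ, l = List.ofFn fun i => List.ofFn (v i) := by
  subst hu
  obtain ⟨_, ⟨gs, h₁, h₂, rfl⟩, -⟩ := ((parses_parseNum.many u).many u _ _ _).1 h
  obtain ⟨f, rfl⟩ := exists_ofFn h₂
  obtain ⟨w, rfl⟩ := exists_ofFn (h₁.length_eq.trans h₂)
  rw [forall₂_ofFn] at h₁
  choose v hv using fun i => exists_ofFn (length_of_many (h₁ i))
  exact ⟨v, by congr 1; funext i; exact hv i⟩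

end StackProg

/-! ### Linear algebra and convexity behind the decision procedure. -/

namespace StackProg

theorem zipWith_ofFn {β γ δ : Type} {d : ℕ} (f : β → γ → δ) (x : Fin d → β) (y : Fin d → γ) :
    List.zipWith f (List.ofFn x) (List.ofFn y) = List.ofFn fun i => f (x i) (y i) := by
  apply List.ext_getElem <;> simp

section Orthogonalization

variable {d : ℕ}

theorem dot_ofFn (x y : Fin d → ℚ) : dot (List.ofFn x) (List.ofFn y) = x ⬝ᵥ y := by
  rw [dot, zipWith_ofFn, List.sum_ofFn, dotProduct]

/-- A multiple of the component of `x` orthogonal to `y`. -/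
def reduceVec (x y : Fin d → ℚ) : Fin d → ℚ := (y ⬝ᵥ y) • x - (x ⬝ᵥ y) • y

theorem reduce_ofFn (x y : Fin d → ℚ) :
    reduce (List.ofFn x) (List.ofFn y) = List.ofFn (reduceVec x y) := by
  rw [reduce, zipWith_ofFn, dot_ofFn, dot_ofFn]
  congr 1
  funext i
  simp [reduceVec, sub_eq_add_neg]

theorem foldl_reduce_ofFn (ws : List (Fin d → ℚ)) (x : Fin d → ℚ) :
    (ws.map List.ofFn).foldl reduce (List.ofFn x) = List.ofFn (ws.foldl reduceVec x) := by
  induction ws generalizing x with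
  | nil => rfl
  | cons y ws ih => simp [reduce_ofFn, ih]

theorem dotProduct_eq_zero_of_mem_span {s : Set (Fin d → ℚ)} {x z : Fin d → ℚ}
    (hx : x ∈ Submodule.span ℚ s) (h : ∀ y ∈ s, y ⬝ᵥ z = 0) : x ⬝ᵥ z = 0 := by
  induction hx using Submodule.span_induction with
  | mem y hy => exact h y hy
  | zero => simp
  | add y w _ _ hy hw => rw [add_dotProduct, hy, hw, add_zero]
  | smul c y _ hy => rw [smul_dotProduct, hy, smul_zero]

/-- Gram–Schmidt with each step multiplied by `y ⬝ᵥ y` instead of divided by it; these factors,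
nonzero because `y ≠ 0`, make up `c`. -/
theorem foldl_reduceVec (ws : List (Fin d → ℚ)) (hws : ws.Pairwise fun x y => y ⬝ᵥ x = 0)
    (h0 : ∀ y ∈ ws, y ≠ 0) (x : Fin d → ℚ) :
    (∃ c : ℚ, c ≠ 0 ∧ ws.foldl reduceVec x - c • x ∈ Submodule.span ℚ {y | y ∈ ws}) ∧
      ∀ y ∈ ws, ws.foldl reduceVec x ⬝ᵥ y = 0 := by
  induction ws generalizing x with
  | nil => exact ⟨⟨1, one_ne_zero, by simp⟩, by simp⟩
  | cons y ws ih =>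
    rw [List.pairwise_cons] at hws
    obtain ⟨⟨c, hc, hm⟩, ho⟩ := ih hws.2 (fun z hz => h0 z (by simp [hz])) (reduceVec x y)
    have hy : y ⬝ᵥ y ≠ 0 := fun h => h0 y (by simp) (dotProduct_self_eq_zero.1 h)
    rw [List.foldl_cons]
    refine ⟨⟨c * (y ⬝ᵥ y), mul_ne_zero hc hy, ?_⟩, ?_⟩
    · have h₁ := Submodule.span_mono (show {z | z ∈ ws} ⊆ {z | z ∈ y :: ws} from
        fun z hz => List.mem_cons_of_mem _ hz) hm
      have h₂ : y ∈ Submodule.span ℚ {z | z ∈ y :: ws} := Submodule.subset_span (by simp)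
      have h₃ := Submodule.sub_mem _ h₁ (Submodule.smul_mem _ (c * (x ⬝ᵥ y)) h₂)
      convert h₃ using 1
      simp only [reduceVec, smul_sub, smul_smul]
      abel
    · intro z hz
      rcases List.mem_cons.1 hz with rfl | hz
      -- The later reductions change the vector, up to a factor, only by multiples of vectors
      -- orthogonal to `z`, so orthogonality to `z` survives them.
      · have h₁ := dotProduct_eq_zero_of_mem_span hm (z := z) fun w hw => hws.1 w hw
        rw [sub_dotProduct, smul_dotProduct, sub_eq_zero] at h₁
        rw [h₁, reduceVec, sub_dotProduct, smul_dotProduct, smul_dotProduct]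
        simp [mul_comm]
      · exact ho z hz

/-- Modulo the span of its predecessors, the next vector reduces to a nonzero multiple `w` of
itself. As `w` is orthogonal to that span, it vanishes exactly if the vector lies in it, and `w ⬝ᵥ
w` detects this, being a sum of rational squares. Equality of spans is carried along to identify
that span in the next step. -/
theorem orthogonalize_ofFn {m : ℕ} (v : Fin m → Fin d → ℚ) :
    (∃ ws : List (Fin d → ℚ), orthogonalize (List.ofFn fun i => List.ofFn (v i)) =
        some (ws.map List.ofFn) ∧ LinearIndependent ℚ v ∧ (ws.Pairwise fun x y => y ⬝ᵥ x = 0) ∧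
        (∀ y ∈ ws, y ≠ 0) ∧ Submodule.span ℚ {y | y ∈ ws} = Submodule.span ℚ (Set.range v)) ∨
      (orthogonalize (List.ofFn fun i => List.ofFn (v i)) = none ∧ ¬ LinearIndependent ℚ v) := by
  induction m with
  | zero =>
    refine .inl ⟨[], rfl, linearIndependent_empty_type, .nil, by simp, ?_⟩
    simp
  | succ m ih =>
    rw [linearIndependent_finSucc', orthogonalize, List.ofFn_succ', List.concat_eq_append, List.foldl_concat]
    change (∃ ws : List (Fin d → ℚ), (orthogonalize (List.ofFn fun i =>
      List.ofFn (Fin.init v i))).bind _ = _ ∧ _) ∨ ((orthogonalize (List.ofFn fun i =>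
      List.ofFn (Fin.init v i))).bind _ = _ ∧ _)
    rcases ih (Fin.init v) with ⟨ws, hws, hli, hp, h0, hs⟩ | ⟨hnone, hli⟩
    · rw [hws]
      simp only [Option.bind_some, foldl_reduce_ofFn, dot_ofFn]
      obtain ⟨⟨c, hc, hm⟩, ho⟩ := foldl_reduceVec ws hp h0 (v (Fin.last m))
      set w := ws.foldl reduceVec (v (Fin.last m)) with hw
      by_cases hww : 0 < w ⬝ᵥ w
      · left
        have hnot : v (Fin.last m) ∉ Submodule.span ℚ (Set.range (Fin.init v)) := by
          intro hv
          rw [← hs] at hv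
          have h₁ := Submodule.add_mem _ hm (Submodule.smul_mem _ c hv)
          rw [sub_add_cancel] at h₁
          refine hww.ne' (dotProduct_eq_zero_of_mem_span h₁ fun y hy => ?_)
          rw [dotProduct_comm]
          exact ho y hy
        refine ⟨w :: ws, by simp [hww], ⟨hli, hnot⟩, ?_, ?_, ?_⟩
        · rw [List.pairwise_cons]
          exact ⟨fun y hy => by rw [dotProduct_comm]; exact ho y hy, hp⟩
        · intro y hy
          rcases List.mem_cons.1 hy with rfl | hy
          · intro h
            rw [h] at hww
            simp at hww
          · exact h0 y hy
        · have h₁ : {y | y ∈ w :: ws} = insert w {y | y ∈ ws} := by ext; simp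
          have h₂ : Set.range v = insert (v (Fin.last m)) (Set.range (Fin.init v)) := by
            conv_lhs => rw [← Fin.snoc_init_self v]
            rw [Fin.range_snoc]
          rw [h₁, h₂, Submodule.span_insert, Submodule.span_insert, hs]
          rw [hs] at hm
          apply le_antisymm
          · refine sup_le ?_ le_sup_right
            rw [Submodule.span_singleton_le_iff_mem]
            have := Submodule.add_mem _ (Submodule.mem_sup_right hm) (Submodule.mem_sup_left
              (Submodule.smul_mem _ c (Submodule.mem_span_singleton_self (v (Fin.last m)))))
            rwa [sub_add_cancel] at this
          · refine sup_le ?_ le_sup_right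
            rw [Submodule.span_singleton_le_iff_mem]
            have := Submodule.smul_mem _ c⁻¹ (Submodule.sub_mem _ (Submodule.mem_sup_left
              (Submodule.mem_span_singleton_self w)) (Submodule.mem_sup_right hm))
            rwa [sub_sub_cancel, inv_smul_smul₀ hc] at this
      · right
        refine ⟨by simp [hww], fun h => h.2 ?_⟩
        have h₁ : 0 ≤ w ⬝ᵥ w := Finset.sum_nonneg fun i _ => mul_self_nonneg (w i)
        have h₂ : w = 0 := dotProduct_self_eq_zero.1 (le_antisymm (not_lt.1 hww) h₁)
        rw [h₂, zero_sub, Submodule.neg_mem_iff, hs] at hm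
        have := Submodule.smul_mem _ c⁻¹ hm
        rwa [inv_smul_smul₀ hc] at this
    · right
      rw [hnone]
      exact ⟨rfl, fun h => hli h.1⟩

theorem orthogonalize_elim {m : ℕ} (v : Fin m → Fin d → ℚ) :
    ((orthogonalize (List.ofFn fun i => List.ofFn (v i))).elim false fun _ => true) = true ↔
      LinearIndependent ℚ v := by
  rcases orthogonalize_ofFn v with ⟨ws, h, hli, -⟩ | ⟨h, hli⟩ <;> simp [h, hli]

end Orthogonalization

section Vertices

variable {d : ℕ}

theorem mem_vertices_ofFn (lo hi : ℚ) {m : ℕ} (v : Fin m → Fin d → ℚ) (x : List ℚ) :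
    x ∈ vertices lo hi (List.ofFn fun _ : Fin d => (0 : ℚ)) (List.ofFn fun i => List.ofFn (v i)) ↔
      ∃ ε : Fin m → Bool, x = List.ofFn (∑ i, (if ε i then hi else lo) • v i) := by
  induction m generalizing x with
  | zero =>
    rw [show (List.ofFn fun _ : Fin d => (0 : ℚ)) = List.ofFn (0 : Fin d → ℚ) from rfl]
    simp [vertices]
  | succ m ih =>
    rw [vertices, List.ofFn_succ', List.concat_eq_append, List.foldl_concat, List.mem_flatMap]
    have ih' := ih (Fin.init v)
    unfold vertices at ih'
    constructor
    · rintro ⟨y, hy, hx⟩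
      obtain ⟨ε, rfl⟩ := (ih' y).1 hy
      simp only [zipWith_ofFn, List.mem_cons, List.not_mem_nil, or_false] at hx
      rcases hx with rfl | rfl
      · refine ⟨Fin.snoc ε false, ?_⟩
        congr 1
        funext j
        simp [Fin.sum_univ_castSucc, Fin.init]
      · refine ⟨Fin.snoc ε true, ?_⟩
        congr 1
        funext j
        simp [Fin.sum_univ_castSucc, Fin.init]
    · rintro ⟨ε, rfl⟩
      refine ⟨_, (ih' _).2 ⟨Fin.init ε, rfl⟩, ?_⟩
      simp only [zipWith_ofFn, List.mem_cons, List.not_mem_nil, or_false]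
      cases h : ε (Fin.last m)
      · left
        congr 1
        funext j
        simp [Fin.sum_univ_castSucc, Fin.init, h, -ite_smul, -smul_ite, -ite_mul]
        rfl
      · right
        congr 1
        funext j
        simp [Fin.sum_univ_castSucc, Fin.init, h, -ite_smul, -smul_ite, -ite_mul]
        rfl

theorem normPow_ofFn (p : ℕ) (x : Fin d → ℚ) : normPow p (List.ofFn x) = ∑ i, |x i| ^ p := by
  rw [normPow, List.map_ofFn, List.sum_ofFn]
  rfl

theorem norm_toLp_pow {p : ℕ} (hp : 1 ≤ p) (x : Fin d → ℝ) :
    ‖WithLp.toLp (p : ENNReal) x‖ ^ p = ∑ i, |x i| ^ p := by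
  have h0 : (p : ℝ) ≠ 0 := by exact_mod_cast (by omega : p ≠ 0)
  rw [PiLp.norm_eq_sum (by simpa using (by omega : 0 < p))]
  simp only [ENNReal.toReal_natCast, Real.rpow_natCast, Real.norm_eq_abs]
  rw [← Real.rpow_natCast, ← Real.rpow_mul (Finset.sum_nonneg fun i _ => by positivity),
    one_div, inv_mul_cancel₀ h0, Real.rpow_one]

theorem convexOn_sum_abs_pow (p : ℕ) :
    ConvexOn ℝ Set.univ fun x : Fin d → ℝ => ∑ i, |x i| ^ p := by
  have h (s : Finset (Fin d)) : ConvexOn ℝ Set.univ fun x : Fin d → ℝ => ∑ i ∈ s, |x i| ^ p := by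
    classical
    induction s using Finset.induction_on with
    | empty => simpa using convexOn_const (0 : ℝ) convex_univ
    | insert i s hi ih =>
      simp only [Finset.sum_insert hi]
      refine ConvexOn.add ?_ ih
      have h₁ : ConvexOn ℝ Set.univ fun t : ℝ => ‖t‖ := convexOn_univ_norm
      exact (h₁.comp_linearMap (LinearMap.proj i : (Fin d → ℝ) →ₗ[ℝ] ℝ)).pow (fun _ _ => norm_nonneg _) p
  exact h _

/-- Each segment is the convex hull of its endpoints, and convex hulls commute with Minkowski sums.
-/
theorem parallelotope_eq_convexHull (lo hi : ℝ) (h : lo ≤ hi) (v : Fin d → Fin d → ℚ) :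
    parallelotope lo hi v = convexHull ℝ (∑ i, ({lo • (fun j => (v i j : ℝ)),
      hi • (fun j => (v i j : ℝ))} : Set (Fin d → ℝ))) := by
  rw [convexHull_sum, parallelotope]
  refine Finset.sum_congr rfl fun i _ => ?_
  rw [convexHull_pair, ← segment_eq_Icc h]
  exact image_segment ℝ ((LinearMap.id (R := ℝ) (M := ℝ)).smulRight
    (fun j => (v i j : ℝ))).toAffineMap lo hi

/-- The reduction to finitely many points. On a convex hull, every value of a convex function is at
most its value at some generating point, here some `X ε`. Existence of the maximum thus follows from
the finiteness of the choices `ε`, without compactness. -/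
theorem maxNormPowGE_iff {p : ℕ} (hp : 1 ≤ p) (lo hi : ℚ) (h : lo ≤ hi) (γ : ℚ)
    (v : Fin d → Fin d → ℚ) : MaxNormPowGE p lo hi γ v ↔
      ∃ ε : Fin d → Bool, γ ≤ ∑ j, |(∑ i, (if ε i then hi else lo) • v i) j| ^ p := by
  set F : (Fin d → ℝ) → ℝ := fun x => ∑ i, |x i| ^ p with hF
  set X : (Fin d → Bool) → Fin d → ℝ := fun ε j => ∑ i, ((if ε i then hi else lo : ℚ) : ℝ) * v i j
    with hX
  have hlh : (lo : ℝ) ≤ hi := by exact_mod_cast h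
  have hmem (ε : Fin d → Bool) : X ε ∈ parallelotope (lo : ℝ) hi v := by
    rw [parallelotope, Set.mem_fintype_sum]
    refine ⟨fun i => ((if ε i then hi else lo : ℚ) : ℝ) • fun j => (v i j : ℝ), fun i => ?_, ?_⟩
    · refine ⟨_, ?_, rfl⟩
      cases ε i <;> simp [hlh]
    · funext j
      simp [hX]
  have hle (x : Fin d → ℝ) (hx : x ∈ parallelotope (lo : ℝ) hi v) : ∃ ε, F x ≤ F (X ε) := by
    rw [parallelotope_eq_convexHull _ _ hlh] at hx
    obtain ⟨y, hy, hxy⟩ := (convexOn_sum_abs_pow p).exists_ge_of_mem_convexHull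
      (Set.subset_univ _) hx
    obtain ⟨g, hg, rfl⟩ := (Set.mem_fintype_sum _ _).1 hy
    have : ∀ i, ∃ b : Bool, g i = ((if b then hi else lo : ℚ) : ℝ) • fun j => (v i j : ℝ) := by
      intro i
      rcases hg i with e | e
      · exact ⟨false, by simpa using e⟩
      · exact ⟨true, by simpa using e⟩
    choose ε hε using this
    refine ⟨ε, hxy.trans_eq ?_⟩
    congr 1
    funext j
    simp [hX, hε]
  -- Values at these points are rational, so the real comparison with `γ` is an exact rational one.
  have hcast (ε : Fin d → Bool) :
      F (X ε) = ((∑ j, |(∑ i, (if ε i then hi else lo) • v i) j| ^ p : ℚ) : ℝ) := by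
    simp only [hF, hX, Finset.sum_apply, Pi.smul_apply, smul_eq_mul]
    push_cast
    refine Finset.sum_congr rfl fun j _ => ?_
    congr 2
  have hnorm : (fun x : Fin d → ℝ => ‖WithLp.toLp (p : ENNReal) x‖ ^ p) = F := by
    funext x
    exact norm_toLp_pow hp x
  rw [MaxNormPowGE, hnorm]
  constructor
  · rintro ⟨m, ⟨⟨x, hx, rfl⟩, -⟩, hm⟩
    obtain ⟨ε, hε⟩ := hle x hx
    refine ⟨ε, ?_⟩
    have := hm.trans hε
    rw [hcast] at this
    exact_mod_cast this
  · rintro ⟨ε, hε⟩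
    obtain ⟨ε', hmax⟩ := Finite.exists_max fun ε => F (X ε)
    refine ⟨F (X ε'), ⟨⟨_, hmem ε', rfl⟩, ?_⟩, ?_⟩
    · rintro _ ⟨x, hx, rfl⟩
      obtain ⟨δ, hδ⟩ := hle x hx
      exact hδ.trans (hmax δ)
    · refine le_trans ?_ (hmax ε)
      rw [hcast]
      exact_mod_cast hε

end Vertices

/-! ### Correctness of the decision procedure, and the theorem. -/

theorem decideParmax_iff {p : ℕ} (hp : 1 ≤ p) (lo hi : ℚ) (h : lo ≤ hi) (x : List RatSym) (k : ℕ) :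
    (x, k) ∈ parmax p lo hi ↔ decideParmax p lo hi (List.replicate k ()) ⟨x⟩ = true := by
  have hz : (List.replicate k ()).map (fun _ => (0 : ℚ)) = List.ofFn fun _ : Fin k => (0 : ℚ) := by
    apply List.ext_getElem <;> simp
  have he : (!(List.ofFn fun _ : Fin k => (0 : ℚ)).isEmpty) = true ↔ 1 ≤ k := by
    cases k <;> simp
  have hv (γ : ℚ) (v : Fin k → Fin k → ℚ) :
      ((vertices lo hi (List.ofFn fun _ : Fin k => (0 : ℚ)) (List.ofFn fun i => List.ofFn (v i))).any
        fun x => !decide (normPow p x < γ)) = true ↔ MaxNormPowGE p lo hi γ v := by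
    rw [maxNormPowGE_iff hp lo hi h, List.any_eq_true]
    constructor
    · rintro ⟨y, hy, hγ⟩
      obtain ⟨ε, rfl⟩ := (mem_vertices_ofFn lo hi v y).1 hy
      rw [normPow_ofFn] at hγ
      exact ⟨ε, by simpa using hγ⟩
    · rintro ⟨ε, hε⟩
      exact ⟨_, (mem_vertices_ofFn lo hi v _).2 ⟨ε, rfl⟩, by rw [normPow_ofFn]; simpa using hε⟩
  have hrep : (List.replicate k ()).length = k := List.length_replicate
  rw [decideParmax, hz]
  constructor
  · rintro ⟨hk, γ, v, hx, hli, hmax⟩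
    -- The parser is a function, so it finds precisely the `γ` and `v` whose existence is assumed.
    obtain ⟨t, h₁, h₂⟩ := (encodesInstance_iff hrep x γ v).1 hx
    rw [h₁, Option.bind_some, h₂, Option.bind_some, Option.elim_some, Bool.and_eq_true,
      Bool.and_eq_true, Bool.and_eq_true, orthogonalize_elim, hv, he]
    exact ⟨⟨hk, rfl⟩, hli, hmax⟩
  · intro H
    cases h₁ : parseNum ⟨x⟩ with
    | none => simp [h₁] at H
    | some y =>
      rw [h₁, Option.bind_some] at H
      cases h₂ : parseMany (parseMany parseNum (List.replicate k ())) (List.replicate k ()) y.2 with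
      | none => simp [h₂] at H
      | some z =>
        obtain ⟨l, t⟩ := z
        obtain ⟨v, rfl⟩ := exists_of_parseMany hrep h₂
        rw [h₂, Option.bind_some, Option.elim_some, Bool.and_eq_true, Bool.and_eq_true,
          Bool.and_eq_true, orthogonalize_elim, hv, he] at H
        obtain ⟨⟨hk, ht⟩, hli, hmax⟩ := H
        have ht' : t = ⟨[]⟩ := by
          cases t
          simpa using ht
        subst ht'
        exact ⟨hk, y.1, v, (encodesInstance_iff hrep x y.1 v).2 ⟨y.2, h₁, h₂⟩, hli, hmax⟩

end StackProg

theorem mainTheorem4 (p : ℕ) (hp : 1 ≤ p) :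
    IsFPT (parmax p 0 1) ∧ IsFPT (parmax p (-1) 1) := by
  have h₀ : StackProg.Feasible fun _ : Unit => (0 : ℚ) :=
    (StackProg.Feasible.ratConst 0).of_eq fun _ => Nat.cast_zero
  have h₁ : StackProg.Feasible fun _ : Unit => (1 : ℚ) :=
    (StackProg.Feasible.ratConst 1).of_eq fun _ => Nat.cast_one
  have h₂ (lo : ℚ) (hlo : StackProg.Feasible fun _ : Unit => lo) (h : lo ≤ 1) :
      IsFPT (parmax p lo (1 : ℚ)) :=
    (StackProg.Feasible.decideParmax p lo 1 hlo h₁).isFPT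
      (StackProg.decideParmax_iff hp lo 1 h)
  exact ⟨by simpa using h₂ 0 h₀ zero_le_one, by simpa using h₂ (-1) h₁.ratNeg (by norm_num)⟩
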